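/- Let $F$ be R. Thompson's group of all piecewise linear increasing homeomorphisms of $[0,1]$ with finitely many break points, all in $\mathbb Z[\frac12]$, and all slopes powers of $2$; products in $F$ are composed from left to right. Let $x_0,x_1\in F$ be the standard generators $$x_0(t)=\begin{cases}2t,&0\le t\le\frac14\\ t+\frac14,&\frac14\le t\le\frac12\\ \frac t2+\frac12,&\frac12\le t\le1\end{cases}\qquad x_1(t)=\begin{cases}t,&0\le t\le\frac12\\ 2t-\frac12,&\frac12\le t\le\frac58\\ t+\frac18,&\frac58\le t\le\frac34\\ \frac t2+\frac12,&\frac34\le t\le1\end{cases}$$ and let $x_2=x_0^{-1}x_1x_0$. For a set $U$ of numbers let $H_U$ be the pointwise stabilizer of $U$ in $F$. The type $\tau(V)$ of a finite set $V\subset[0,1]$ is the word obtained by listing $V$ in increasing order and replacing each element by $1$ if it is in $\mathbb Z[\frac12]$, by $2$ if it is rational but not in $\mathbb Z[\frac12]$, and by $3$ if it is irrational. If $V$ has least element $a$ and greatest element $b$, put $B_V=F_{[a,b]}\cap H_{V\setminus\{a,b\}}$, where $F_{[a,b]}$ is the group of elements of $F$ with support in $[a,b]$. The ascending HNN-extension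 of a group $G$ along an injective endomorphism $\psi$ of $G$ is $\langle G,t\mid t^{-1}gt=\psi(g),\ g\in G\rangle$, with stable letter $t$; an iterated ascending HNN-extension of $K$ with stable letters $t_1,\dots,t_m$ is obtained from $K$ by $m$ successive ascending HNN-extensions, each of the group obtained so far, the $j$-th one having stable letter $t_j$. Let $m\ge 0$ and let $U$ be a set of $m$ rational numbers in $(0,1)\setminus\mathbb Z[\frac12]$. Then $H_U\cong B_V$ for every finite set $V\subset[0,1]$ of type $12^m1$. Moreover, $H_U$ is isomorphic to an iterated ascending HNN-extension of $K=F^{m+1}$ with $m$ stable letters $t_1,\dots,t_m$ such that $t_i$ and $t_j$ commute for all $i,j$, $t_j^{-1}Kt_j$ is a proper subgroup of $K$ for every $j$, and $t_j^{-1}kt_j=\phi_j(k)$ for all $k\in K$, where $\phi_j$ is the endomorphism of $K$ given as follows. Let $\iota_i$ be the injection of $F$ as the $i$-th direct factor of $F^{m+1}$. Then $$\begin{array}{ll}\phi_j\colon &\iota_i(x_0)\mapsto\iota_i(x_0),\quad \iota_i(x_1)\mapsto\iota_i(x_1)\quad\text{for all } i\notin\{j,j+1\},\\ &\iota_j(x_0)\mapsto\iota_j(x_0x_1x_0^{-1}),\\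 &\iota_j(x_1)\mapsto\iota_j(x_1),\\ &\iota_{j+1}(x_0)\mapsto\iota_{j+1}(x_0x_1^{-1}),\\ &\iota_{j+1}(x_1)\mapsto\iota_{j+1}(x_1^2x_2^{-1}x_1^{-1}).\end{array}$$ -/

import Mathlib

noncomputable section

namespace ThompsonStab

/-! ### Thompson's group `F` -/

/-- Elements of `ℤ[1/2]`. -/
def IsDyadic (x : ℝ) : Prop := ∃ (k : ℤ) (n : ℕ), x = k / 2 ^ n

theorem IsDyadic.zero : IsDyadic 0 := ⟨0, 0, by simp⟩

theorem IsDyadic.add {x y : ℝ} (hx : IsDyadic x) (hy : IsDyadic y) : IsDyadic (x + y) := by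
  obtain ⟨k, n, rfl⟩ := hx
  obtain ⟨l, p, rfl⟩ := hy
  refine ⟨k * 2 ^ p + l * 2 ^ n, n + p, ?_⟩
  push_cast
  field_simp
  ring

theorem IsDyadic.neg {x : ℝ} (hx : IsDyadic x) : IsDyadic (-x) := by
  obtain ⟨k, n, rfl⟩ := hx
  exact ⟨-k, n, by push_cast; ring⟩

theorem IsDyadic.zpow_mul {x : ℝ} (hx : IsDyadic x) (n : ℤ) : IsDyadic ((2 : ℝ) ^ n * x) := by
  obtain ⟨k, p, rfl⟩ := hx
  obtain ⟨q, rfl | rfl⟩ := n.eq_nat_or_neg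
  · exact ⟨2 ^ q * k, p, by push_cast; rw [zpow_natCast]; ring⟩
  · refine ⟨k, p + q, ?_⟩
    rw [zpow_neg, zpow_natCast, pow_add]
    field_simp

/-- The unit interval `[0,1]`. -/
abbrev I : Type := Set.Icc (0 : ℝ) 1

/-- An increasing bijection of `[0,1]` (automatically a homeomorphism) is *piecewise dyadic* if
there is a finite set `D` of dyadic break points such that on every interval without a break
point in its interior the map is affine with slope a power of `2`. -/
def IsPLDyadic (f : I ≃o I) : Prop :=
  ∃ D : Finset ℝ, (∀ d ∈ D, IsDyadic d) ∧
    ∀ a b : I, a < b → (∀ d ∈ D, ¬ ((a : ℝ) < d ∧ d < b)) →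
      ∃ (n : ℤ) (c : ℝ), ∀ x : I, a ≤ x → x ≤ b → (f x : ℝ) = 2 ^ n * (x : ℝ) + c

theorem IsPLDyadic.map_dyadic {f : I ≃o I} (hf : IsPLDyadic f) :
    ∀ x : I, IsDyadic x → IsDyadic (f x) := by
  obtain ⟨D, hD, h⟩ := hf
  suffices H : ∀ (N : ℕ) (x : I), (D.filter (fun d => d < (x : ℝ))).card ≤ N →
      IsDyadic x → IsDyadic (f x) from fun x hx => H _ x le_rfl hx
  have key : ∀ a x : I, a < x → (∀ d ∈ D, ¬ ((a : ℝ) < d ∧ d < x)) → IsDyadic a →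
      IsDyadic (f a) → IsDyadic x → IsDyadic (f x) := by
    intro a x hax hfree ha hfa hx
    obtain ⟨n, c, hc⟩ := h a x hax hfree
    have h1 := hc a le_rfl hax.le
    have h2 := hc x hax.le le_rfl
    have : (f x : ℝ) = f a + (2 ^ n * (x : ℝ) + -(2 ^ n * (a : ℝ))) := by rw [h1, h2]; ring
    rw [this]
    exact hfa.add ((hx.zpow_mul n).add (ha.zpow_mul n).neg)
  have hbot : f ⊥ = ⊥ := f.map_bot
  have hb0 : ((⊥ : I) : ℝ) = 0 := rfl
  have hfbot : IsDyadic (f ⊥) := by rw [hbot, hb0]; exact IsDyadic.zero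
  intro N
  induction N with
  | zero =>
    intro x hN hx
    have hemp : D.filter (fun d => d < (x : ℝ)) = ∅ := Finset.card_eq_zero.1 (by omega)
    rcases eq_or_lt_of_le (bot_le : (⊥ : I) ≤ x) with h0 | h0
    · rw [← h0]; exact hfbot
    · refine key ⊥ x h0 (fun d hd hlt => ?_) (by rw [hb0]; exact IsDyadic.zero) hfbot hx
      have : d ∈ D.filter (fun d => d < (x : ℝ)) := Finset.mem_filter.2 ⟨hd, hlt.2⟩
      rw [hemp] at this
      simp at this
  | succ N ih =>
    intro x hN hx
    rcases eq_or_lt_of_le (bot_le : (⊥ : I) ≤ x) with h0 | h0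
    · rw [← h0]; exact hfbot
    by_cases hne : (D.filter (fun d => 0 < d ∧ d < (x : ℝ))).Nonempty
    · set E := D.filter (fun d => 0 < d ∧ d < (x : ℝ)) with hE
      have hmem := E.max'_mem hne
      have hm := Finset.mem_filter.1 hmem
      set a := E.max' hne with ha
      have hx1 := x.2.2
      let a' : I := ⟨a, hm.2.1.le, by linarith [hm.2.2]⟩
      have hlt : a' < x := hm.2.2
      refine key a' x hlt (fun d hd hlt' => ?_) (hD a hm.1) (ih a' ?_ (hD a hm.1)) hx
      · have hdE : d ∈ E := Finset.mem_filter.2 ⟨hd, lt_trans hm.2.1 hlt'.1, hlt'.2⟩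
        exact absurd (E.le_max' d hdE) (not_le.2 hlt'.1)
      · have hss : D.filter (fun d => d < (a' : ℝ)) ⊂ D.filter (fun d => d < (x : ℝ)) := by
          refine (Finset.ssubset_iff_of_subset ?_).2 ⟨a, ?_, ?_⟩
          · intro d hd
            rw [Finset.mem_filter] at hd ⊢
            exact ⟨hd.1, lt_trans hd.2 hlt⟩
          · exact Finset.mem_filter.2 ⟨hm.1, hm.2.2⟩
          · intro hc
            exact lt_irrefl _ (Finset.mem_filter.1 hc).2
        have := Finset.card_lt_card hss
        omega
    · refine key ⊥ x h0 (fun d hd hlt => hne ⟨d, ?_⟩) (by rw [hb0]; exact IsDyadic.zero) hfbot hx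
      exact Finset.mem_filter.2 ⟨hd, by rw [hb0] at hlt; exact hlt⟩

theorem IsPLDyadic.symm {f : I ≃o I} (hf : IsPLDyadic f) : IsPLDyadic f.symm := by
  classical
  have hmap := hf.map_dyadic
  obtain ⟨D, hD, h⟩ := hf
  refine ⟨(D.subtype (fun d => d ∈ Set.Icc (0 : ℝ) 1)).image (fun d => (f d : ℝ)), ?_, ?_⟩
  · intro d hd
    obtain ⟨e, he, rfl⟩ := Finset.mem_image.1 hd
    exact hmap e (hD _ (Finset.mem_subtype.1 he))
  · intro a b hab hfree
    obtain ⟨n, c, hc⟩ := h (f.symm a) (f.symm b) (f.symm.lt_iff_lt.2 hab) (by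
      rintro d hd ⟨h1, h2⟩
      have hdI : d ∈ Set.Icc (0 : ℝ) 1 :=
        ⟨(f.symm a).2.1.trans h1.le, h2.le.trans (f.symm b).2.2⟩
      refine hfree (f ⟨d, hdI⟩) (Finset.mem_image.2 ⟨⟨d, hdI⟩, Finset.mem_subtype.2 hd, rfl⟩) ?_
      have h1' : f.symm a < ⟨d, hdI⟩ := h1
      have h2' : (⟨d, hdI⟩ : I) < f.symm b := h2
      exact ⟨(f.symm_apply_lt).1 h1', (f.lt_symm_apply).1 h2'⟩)
    refine ⟨-n, -(2 ^ (-n) * c), fun x hx1 hx2 => ?_⟩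
    have := hc (f.symm x) (f.symm.le_iff_le.2 hx1) (f.symm.le_iff_le.2 hx2)
    rw [f.apply_symm_apply] at this
    have h2 : (2 : ℝ) ^ (-n) * 2 ^ n = 1 := by
      rw [← zpow_add₀ (by norm_num : (2 : ℝ) ≠ 0)]; simp
    rw [this]
    linear_combination (-(f.symm x : ℝ)) * h2

theorem IsPLDyadic.trans {f g : I ≃o I} (hf : IsPLDyadic f) (hg : IsPLDyadic g) :
    IsPLDyadic (f.trans g) := by
  classical
  have hmap := hf.symm.map_dyadic
  obtain ⟨D, hD, h⟩ := hf
  obtain ⟨E, hE, k⟩ := hg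
  refine ⟨D ∪ (E.subtype (fun d => d ∈ Set.Icc (0 : ℝ) 1)).image (fun d => (f.symm d : ℝ)), ?_, ?_⟩
  · intro d hd
    rcases Finset.mem_union.1 hd with hd | hd
    · exact hD d hd
    · obtain ⟨e, he, rfl⟩ := Finset.mem_image.1 hd
      exact hmap e (hE _ (Finset.mem_subtype.1 he))
  · intro a b hab hfree
    obtain ⟨n, c, hc⟩ := h a b hab (fun d hd => hfree d (Finset.mem_union_left _ hd))
    obtain ⟨p, e, he⟩ := k (f a) (f b) (f.lt_iff_lt.2 hab) (by
      rintro d hd ⟨h1, h2⟩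
      have hdI : d ∈ Set.Icc (0 : ℝ) 1 := ⟨(f a).2.1.trans h1.le, h2.le.trans (f b).2.2⟩
      refine hfree (f.symm ⟨d, hdI⟩) (Finset.mem_union_right _
        (Finset.mem_image.2 ⟨⟨d, hdI⟩, Finset.mem_subtype.2 hd, rfl⟩)) ?_
      have h1' : f a < ⟨d, hdI⟩ := h1
      have h2' : (⟨d, hdI⟩ : I) < f b := h2
      exact ⟨(f.lt_symm_apply).2 h1', (f.symm_apply_lt).2 h2'⟩)
    refine ⟨p + n, 2 ^ p * c + e, fun x hx1 hx2 => ?_⟩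
    have h1 := he (f x) (f.le_iff_le.2 hx1) (f.le_iff_le.2 hx2)
    have h2 := hc x hx1 hx2
    rw [OrderIso.trans_apply, h1, h2, zpow_add₀ (by norm_num : (2 : ℝ) ≠ 0)]
    ring

/-- Thompson's group `F`. The opposite group is used because composition in `F` is from left to
right: in `(I ≃o I)ᵐᵒᵖ` the product `f * g` means "first `f`, then `g`". -/
def F : Subgroup (I ≃o I)ᵐᵒᵖ where
  carrier := {f | IsPLDyadic f.unop}
  mul_mem' := fun hf hg => IsPLDyadic.trans hf hg
  one_mem' := ⟨∅, by simp, fun _ _ _ _ => ⟨0, 0, fun x _ _ => by simp⟩⟩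
  inv_mem' := fun hf => IsPLDyadic.symm hf

/-- The value of `f ∈ F` at a point of `[0,1]`. -/
def F.val (f : F) (x : I) : I := f.1.unop x

theorem F.val_one (x : I) : F.val 1 x = x := rfl

theorem F.val_mul (f g : F) (x : I) : F.val (f * g) x = F.val g (F.val f x) := rfl

theorem F.val_inv_eq {f : F} {x : I} (h : F.val f x = x) : F.val f⁻¹ x = x := by
  have : F.val f⁻¹ (F.val f x) = x := by rw [← F.val_mul, mul_inv_cancel, F.val_one]
  rwa [h] at this

/-! ### The generators -/

/-- The function `x₀`. -/
def x0Fun (t : ℝ) : ℝ :=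
  if t ≤ 1 / 4 then 2 * t else if t ≤ 1 / 2 then t + 1 / 4 else t / 2 + 1 / 2

def x0Inv (t : ℝ) : ℝ :=
  if t ≤ 1 / 2 then t / 2 else if t ≤ 3 / 4 then t - 1 / 4 else 2 * t - 1

/-- The function `x₁`. -/
def x1Fun (t : ℝ) : ℝ :=
  if t ≤ 1 / 2 then t else if t ≤ 5 / 8 then 2 * t - 1 / 2
  else if t ≤ 3 / 4 then t + 1 / 8 else t / 2 + 1 / 2

def x1Inv (t : ℝ) : ℝ :=
  if t ≤ 1 / 2 then t else if t ≤ 3 / 4 then t / 2 + 1 / 4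
  else if t ≤ 7 / 8 then t - 1 / 8 else 2 * t - 1

/-- `x₀` as an increasing bijection of `[0,1]`. -/
def x0Iso : I ≃o I where
  toFun t := ⟨x0Fun t, by
    have h := t.2; simp only [Set.mem_Icc] at h ⊢
    unfold x0Fun; split_ifs <;> constructor <;> linarith⟩
  invFun t := ⟨x0Inv t, by
    have h := t.2; simp only [Set.mem_Icc] at h ⊢
    unfold x0Inv; split_ifs <;> constructor <;> linarith⟩
  left_inv t := by
    apply Subtype.ext
    change x0Inv (x0Fun t) = t
    unfold x0Inv x0Fun; split_ifs <;> linarith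
  right_inv t := by
    apply Subtype.ext
    change x0Fun (x0Inv t) = t
    unfold x0Inv x0Fun; split_ifs <;> linarith
  map_rel_iff' := by
    intro s t
    change x0Fun s ≤ x0Fun t ↔ (s : ℝ) ≤ t
    unfold x0Fun; split_ifs <;> constructor <;> intro h <;> linarith

/-- `x₁` as an increasing bijection of `[0,1]`. -/
def x1Iso : I ≃o I where
  toFun t := ⟨x1Fun t, by
    have h := t.2; simp only [Set.mem_Icc] at h ⊢
    unfold x1Fun; split_ifs <;> constructor <;> linarith⟩
  invFun t := ⟨x1Inv t, by
    have h := t.2; simp only [Set.mem_Icc] at h ⊢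
    unfold x1Inv; split_ifs <;> constructor <;> linarith⟩
  left_inv t := by
    apply Subtype.ext
    change x1Inv (x1Fun t) = t
    unfold x1Inv x1Fun; split_ifs <;> linarith
  right_inv t := by
    apply Subtype.ext
    change x1Fun (x1Inv t) = t
    unfold x1Inv x1Fun; split_ifs <;> linarith
  map_rel_iff' := by
    intro s t
    change x1Fun s ≤ x1Fun t ↔ (s : ℝ) ≤ t
    unfold x1Fun; split_ifs <;> constructor <;> intro h <;> linarith

theorem isPLDyadic_x0 : IsPLDyadic x0Iso := by
  classical
  refine ⟨{1 / 4, 1 / 2}, ?_, ?_⟩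
  · intro d hd
    simp only [Finset.mem_insert, Finset.mem_singleton] at hd
    rcases hd with rfl | rfl
    · exact ⟨1, 2, by norm_num⟩
    · exact ⟨1, 1, by norm_num⟩
  · intro a b hab hfree
    have h1 := hfree (1 / 4) (by simp)
    have h2 := hfree (1 / 2) (by simp)
    have hab' : (a : ℝ) < b := hab
    rcases le_or_gt (b : ℝ) (1 / 4) with hb | hb
    · refine ⟨1, 0, fun x _ hx => ?_⟩
      have hx' : (x : ℝ) ≤ b := hx
      change x0Fun x = _
      unfold x0Fun
      rw [if_pos (by linarith)]; norm_num
    have ha : 1 / 4 ≤ (a : ℝ) := not_lt.1 fun h => h1 ⟨h, hb⟩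
    rcases le_or_gt (b : ℝ) (1 / 2) with hb' | hb'
    · refine ⟨0, 1 / 4, fun x hx1 hx2 => ?_⟩
      have hx1' : (a : ℝ) ≤ x := hx1
      have hx2' : (x : ℝ) ≤ b := hx2
      change x0Fun x = _
      unfold x0Fun; split_ifs <;> norm_num <;> linarith
    have ha' : 1 / 2 ≤ (a : ℝ) := not_lt.1 fun h => h2 ⟨h, hb'⟩
    refine ⟨-1, 1 / 2, fun x hx1 hx2 => ?_⟩
    have hx1' : (a : ℝ) ≤ x := hx1
    have hx2' : (x : ℝ) ≤ b := hx2
    change x0Fun x = _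
    unfold x0Fun; split_ifs <;> norm_num <;> linarith

theorem isPLDyadic_x1 : IsPLDyadic x1Iso := by
  classical
  refine ⟨{1 / 2, 5 / 8, 3 / 4}, ?_, ?_⟩
  · intro d hd
    simp only [Finset.mem_insert, Finset.mem_singleton] at hd
    rcases hd with rfl | rfl | rfl
    · exact ⟨1, 1, by norm_num⟩
    · exact ⟨5, 3, by norm_num⟩
    · exact ⟨3, 2, by norm_num⟩
  · intro a b hab hfree
    have h1 := hfree (1 / 2) (by simp)
    have h2 := hfree (5 / 8) (by simp)
    have h3 := hfree (3 / 4) (by simp)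
    have hab' : (a : ℝ) < b := hab
    rcases le_or_gt (b : ℝ) (1 / 2) with hb | hb
    · refine ⟨0, 0, fun x _ hx => ?_⟩
      have hx' : (x : ℝ) ≤ b := hx
      change x1Fun x = _
      unfold x1Fun
      rw [if_pos (by linarith)]; norm_num
    have ha : 1 / 2 ≤ (a : ℝ) := not_lt.1 fun h => h1 ⟨h, hb⟩
    rcases le_or_gt (b : ℝ) (5 / 8) with hb' | hb'
    · refine ⟨1, -(1 / 2), fun x hx1 hx2 => ?_⟩
      have hx1' : (a : ℝ) ≤ x := hx1
      have hx2' : (x : ℝ) ≤ b := hx2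
      change x1Fun x = _
      unfold x1Fun; split_ifs <;> norm_num <;> linarith
    have ha' : 5 / 8 ≤ (a : ℝ) := not_lt.1 fun h => h2 ⟨h, hb'⟩
    rcases le_or_gt (b : ℝ) (3 / 4) with hb'' | hb''
    · refine ⟨0, 1 / 8, fun x hx1 hx2 => ?_⟩
      have hx1' : (a : ℝ) ≤ x := hx1
      have hx2' : (x : ℝ) ≤ b := hx2
      change x1Fun x = _
      unfold x1Fun; split_ifs <;> norm_num <;> linarith
    have ha'' : 3 / 4 ≤ (a : ℝ) := not_lt.1 fun h => h3 ⟨h, hb''⟩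
    refine ⟨-1, 1 / 2, fun x hx1 hx2 => ?_⟩
    have hx1' : (a : ℝ) ≤ x := hx1
    have hx2' : (x : ℝ) ≤ b := hx2
    change x1Fun x = _
    unfold x1Fun; split_ifs <;> norm_num <;> linarith

/-- The generator `x₀` of `F`. -/
def x0 : F := ⟨MulOpposite.op x0Iso, isPLDyadic_x0⟩

/-- The generator `x₁` of `F`. -/
def x1 : F := ⟨MulOpposite.op x1Iso, isPLDyadic_x1⟩

/-- `x₂ = x₀⁻¹ x₁ x₀`. -/
def x2 : F := x0⁻¹ * x1 * x0

/-! ### Stabilizers -/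

/-- `H_U`: the pointwise stabilizer in `F` of a set `U` of numbers. -/
def stab (U : Set ℝ) : Subgroup F where
  carrier := {f | ∀ x : I, (x : ℝ) ∈ U → F.val f x = x}
  mul_mem' := by
    intro f g hf hg x hx
    rw [F.val_mul, hf x hx, hg x hx]
  one_mem' := fun x _ => F.val_one x
  inv_mem' := fun hf x hx => F.val_inv_eq (hf x hx)

/-- `F_{[a,b]}`: the elements of `F` with support in `[a,b]`. As `[a,b]` is closed, this means
that all points outside `[a,b]` are fixed. -/
def supportedIn (a b : ℝ) : Subgroup F := stab {x | x ∉ Set.Icc a b}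

/-- `B_V = F_{[a,b]} ∩ H_{V \ {a,b}}`, with `a` and `b` the least and the greatest element of
the (non-empty) finite set `V`. -/
def B (V : Finset ℝ) : Subgroup F :=
  supportedIn (sInf (V : Set ℝ)) (sSup (V : Set ℝ)) ⊓
    stab ((V : Set ℝ) \ {sInf (V : Set ℝ), sSup (V : Set ℝ)})

open Classical in
/-- The class of a number: `1` for elements of `ℤ[1/2]`, `2` for the other rational numbers,
`3` for irrational numbers. -/
def numberClass (x : ℝ) : ℕ :=
  if IsDyadic x then 1 else if x ∈ Set.range ((↑) : ℚ → ℝ) then 2 else 3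

/-- The type `τ(V)` of a finite set of numbers: the word formed by the classes of its elements
in increasing order. -/
def typeWord (V : Finset ℝ) : List ℕ := (V.sort (· ≤ ·)).map numberClass

/-! ### Iterated ascending HNN-extensions -/

universe u

/-- The ascending HNN-extension `⟨G, t ∣ t⁻¹ g t = ψ g, g ∈ G⟩` of `G` along an injective
endomorphism `ψ`. -/
abbrev AscHNN {G : Type u} [Group G] (ψ : G →* G) (hψ : Function.Injective ψ) : Type u :=
  HNNExtension G ψ.range ⊤ ((MonoidHom.ofInjective hψ).symm.trans Subgroup.topEquiv.symm)

/-- The defining relation, as a check of the conventions. -/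
theorem AscHNN.conj_t {G : Type u} [Group G] (ψ : G →* G) (hψ : Function.Injective ψ) (g : G) :
    (HNNExtension.t : AscHNN ψ hψ)⁻¹ * HNNExtension.of g * HNNExtension.t
      = HNNExtension.of (ψ g) := by
  have h := HNNExtension.equiv_symm_eq_conj
    (φ := (MonoidHom.ofInjective hψ).symm.trans Subgroup.topEquiv.symm) ⟨g, Subgroup.mem_top g⟩
  exact h.symm

/-- `IsIteratedAscHNN K m G ι t`: the group `G` is an iterated ascending HNN-extension of the
group `K` with `m` stable letters `t 0, …, t (m-1)`, where `ι : K →* G` is the embedding of the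
base group. For `m = 0` this means that `ι` is an isomorphism. For `m + 1` it means that `G` is
isomorphic to an ascending HNN-extension, with stable letter `t m`, of an iterated ascending
HNN-extension of `K` with stable letters `t 0, …, t (m-1)`. -/
inductive IsIteratedAscHNN (K : Type u) [Group K] :
    (m : ℕ) → (G : Type u) → [Group G] → (K →* G) → (Fin m → G) → Prop
  | base {G : Type u} [Group G] (ι : K →* G) (t : Fin 0 → G) (hι : Function.Bijective ι) :
      IsIteratedAscHNN K 0 G ι t
  | step {m : ℕ} {G₀ : Type u} [Group G₀] (ι₀ : K →* G₀) (t₀ : Fin m → G₀)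
      (h₀ : IsIteratedAscHNN K m G₀ ι₀ t₀)
      (ψ : G₀ →* G₀) (hψ : Function.Injective ψ)
      {G : Type u} [Group G] (e : AscHNN ψ hψ ≃* G) (ι : K →* G) (t : Fin (m + 1) → G)
      (hι : ∀ k, ι k = e (HNNExtension.of (ι₀ k)))
      (ht : ∀ i : Fin m, t i.castSucc = e (HNNExtension.of (t₀ i)))
      (hlast : t (Fin.last m) = e HNNExtension.t) :
      IsIteratedAscHNN K (m + 1) G ι t

/-- The base group `F^{m+1}`. -/
abbrev BaseGroup (m : ℕ) : Type := Fin (m + 1) → F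

/-- The injection of `F` as the `i`-th direct factor of `F^{m+1}`. -/
abbrev incl {m : ℕ} (i : Fin (m + 1)) : F →* BaseGroup m :=
  MonoidHom.mulSingle (fun _ : Fin (m + 1) => (F : Type)) i

end ThompsonStab

end

noncomputable section

namespace ThompsonStab

/-! ### Ascending HNN-extensions with commuting stable letters -/

section Abstract

open Subgroup

/-! Extend the elements of `F` by the identity to the line. Then `H_U` and `B_V` are both of the
form `fixer v`, where `v` is a decreasing sequence with dyadic ends and `m` inner points that are
rational but not dyadic. Break points are dyadic, so near an inner point `u` every element of `fixer
v` has the form `y ↦ u + 2 ^ n * (y - u)`. The slopes at the inner points are therefore `m`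
characters, and the exponents `n` that can occur at `u` are multiples of some `e > 0`
(`exists_order`).

Elements that are trivial on fixed dyadic neighbourhoods `[a j, b j]` of the inner points form a
copy of `F^{m+1}`, one factor for each complementary interval. The letter `t j` contracts `[a j, b
j]` towards the inner point with slope `2 ^ (-e j)`, the smallest contraction that can occur.
Multiplying by powers of the letters makes all slopes equal to `1`. Conjugating by powers of them
then spreads triviality from a tiny neighbourhood to all of `[a j, b j]`. So the letters and the
base generate (`Frame.base_sup_letters`).

The frame is chosen so that `(t j)⁻¹` looks, in coordinates on the two adjacent intervals, like two
fixed contractions of `[0,1]`, onto `[1/4,1]` and `[0,3/4]`. Conjugation by these gives the formulas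
for `φ j` (`Frame.s_conj_factor`, `endLeft_x0` and its companions). The contraction onto `[1/4,1]`
belongs to the interval on the right of the inner point. As it has to act on the `j`-th factor and
the other one on the next factor, intervals are numbered from right to left.

It remains to see that nothing else enters the group structure. With the conjugation relations
(`AscRel`), an injective base, characters separating the letters (`AscChar`) and generation, the
group is an iterated ascending HNN-extension (`AscRel.isIteratedAscHNN`) and is determined up to
isomorphism (`nonempty_mulEquiv_of_ascRel`). The numbers `e j` depend on the points, but the
relations do not, whence `H_U ≅ B_V`. -/

theorem exists_normal_form {G : Type*} [Group G] {H : Subgroup G} {t : G}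
    (ht : ∀ h ∈ H, t⁻¹ * h * t ∈ H) {g : G} (hg : g ∈ H ⊔ zpowers t) :
    ∃ (n k : ℕ), ∃ h ∈ H, g = t ^ n * h * (t ^ k)⁻¹ := by
  have hpow : ∀ (n : ℕ), ∀ h ∈ H, (t ^ n)⁻¹ * h * t ^ n ∈ H := by
    intro n
    induction n with
    | zero => intro h hh; simpa using hh
    | succ n ih =>
      intro h hh
      have := ht _ (ih h hh)
      rw [pow_succ, mul_inv_rev]
      simpa only [mul_assoc] using this
  rw [zpowers_eq_closure, ← closure_eq H, ← Subgroup.closure_union] at hg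
  -- The words `t ^ n * h * (t ^ k)⁻¹` absorb generators from the left: `x ∈ H` passes `t ^ n` by
  -- conjugation into `H`, and so does `t⁻¹` pass `h` when `n = 0`.
  have hH : ∀ x ∈ H, ∀ (n k : ℕ), ∀ h ∈ H, ∃ (n' k' : ℕ), ∃ h' ∈ H,
      x * (t ^ n * h * (t ^ k)⁻¹) = t ^ n' * h' * (t ^ k')⁻¹ := fun x hx n k h hh =>
    ⟨n, k, _, H.mul_mem (hpow n x hx) hh, by group⟩
  induction hg using closure_induction_left with
  | one => exact ⟨0, 0, 1, H.one_mem, by simp⟩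
  | mul_left x hx y _ ih =>
    obtain ⟨n, k, h, hh, rfl⟩ := ih
    rcases hx with hx | hx
    · exact hH x hx n k h hh
    · rw [Set.mem_singleton_iff] at hx
      subst hx
      exact ⟨n + 1, k, h, hh, by rw [pow_succ']; simp only [mul_assoc]⟩
  | inv_mul_cancel x hx y _ ih =>
    obtain ⟨n, k, h, hh, rfl⟩ := ih
    rcases hx with hx | hx
    · exact hH x⁻¹ (H.inv_mem hx) n k h hh
    · rw [Set.mem_singleton_iff] at hx
      subst hx
      cases n with
      | zero => exact ⟨0, k + 1, _, ht h hh, by group⟩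
      | succ n => exact ⟨n, k, h, hh, by rw [pow_succ']; group⟩

/-- In the normal form `t ^ n * h * (t ^ k)⁻¹` of an element killed by `f`, the character forces `n
= k`, since powers of a positive real other than `1` are distinct. The element is then a conjugate
of `h`, and `f` is injective on `H`. This is the injectivity criterion behind everything that
follows. -/
theorem eq_one_of_mem_sup_zpowers {G G₁ : Type*} [Group G] [Group G₁] {H : Subgroup G} {t : G}
    (ht : ∀ h ∈ H, t⁻¹ * h * t ∈ H) (f : G →* G₁) (hf : ∀ h ∈ H, f h = 1 → h = 1)
    (χ : G₁ →* ℝ) (hχ : ∀ h ∈ H, χ (f h) = 1) (h0 : 0 < χ (f t)) (h1 : χ (f t) ≠ 1)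
    {g : G} (hg : g ∈ H ⊔ zpowers t) (hfg : f g = 1) : g = 1 := by
  obtain ⟨n, k, h, hh, rfl⟩ := exists_normal_form ht hg
  have e1 : f t ^ n * f h = f t ^ k := by
    rw [map_mul, map_mul, map_inv, map_pow, map_pow, mul_inv_eq_one] at hfg
    exact hfg
  have e2 : χ (f t) ^ n = χ (f t) ^ k := by
    have := congrArg χ e1
    rwa [map_mul, hχ h hh, mul_one, map_pow, map_pow] at this
  have e3 : n = k := pow_right_injective₀ h0 h1 e2
  subst e3
  rw [hf h hh (by simpa using e1)]
  simp

variable {K G G₁ : Type*} [Group K] [Group G] [Group G₁]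

/-- The conjugation relations of an iterated ascending HNN-extension of `K` with commuting
stable letters `t j` acting on `K` by the endomorphisms `φ j`. -/
structure AscRel {m : ℕ} (φ : Fin m → K →* K) (ι : K →* G) (t : Fin m → G) : Prop where
  comm : ∀ i j, Commute (t i) (t j)
  conj : ∀ j k, (t j)⁻¹ * ι k * t j = ι (φ j k)

theorem AscRel.castSucc {m : ℕ} {φ : Fin (m + 1) → K →* K} {ι : K →* G} {t : Fin (m + 1) → G}
    (h : AscRel φ ι t) : AscRel (fun j => φ j.castSucc) ι (fun j => t j.castSucc) :=
  ⟨fun _ _ => h.comm _ _, fun _ _ => h.conj _ _⟩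

theorem closure_range_fin_succ {m : ℕ} (t : Fin (m + 1) → G) :
    closure (Set.range t) =
      closure (Set.range fun j : Fin m => t j.castSucc) ⊔ zpowers (t (Fin.last m)) := by
  rw [zpowers_eq_closure, ← Subgroup.closure_union]
  congr 1
  ext x
  constructor
  · rintro ⟨j, rfl⟩
    induction j using Fin.lastCases with
    | last => right; rfl
    | cast j => left; exact ⟨j, rfl⟩
  · rintro (⟨j, rfl⟩ | rfl)
    · exact ⟨_, rfl⟩
    · exact ⟨_, rfl⟩

/-- The last letter maps the base into itself and commutes with the earlier letters, so each stage
of the iteration is again ascending. -/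
theorem AscRel.conj_last_mem {m : ℕ} {φ : Fin (m + 1) → K →* K} {ι : K →* G}
    {t : Fin (m + 1) → G} (h : AscRel φ ι t) {x : G}
    (hx : x ∈ ι.range ⊔ closure (Set.range fun j : Fin m => t j.castSucc)) :
    (t (Fin.last m))⁻¹ * x * t (Fin.last m) ∈
      ι.range ⊔ closure (Set.range fun j : Fin m => t j.castSucc) := by
  set H := ι.range ⊔ closure (Set.range fun j : Fin m => t j.castSucc) with hH
  have : H ≤ H.comap (MulAut.conj (t (Fin.last m))⁻¹).toMonoidHom := by
    conv_lhs => rw [hH]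
    refine sup_le ?_ ((closure_le _).2 ?_)
    · rintro _ ⟨k, rfl⟩
      refine mem_comap.2 (mem_sup_left ⟨φ (Fin.last m) k, ?_⟩)
      rw [← h.conj]
      simp
    · rintro _ ⟨j, rfl⟩
      refine mem_comap.2 ?_
      have e : (MulAut.conj (t (Fin.last m))⁻¹).toMonoidHom (t j.castSucc) = t j.castSucc := by
        have := (h.comm (Fin.last m) j.castSucc).inv_left
        simp only [MulEquiv.coe_toMonoidHom, MulAut.conj_apply]
        rw [this.eq]; group
      rw [e]
      exact mem_sup_right (subset_closure ⟨j, rfl⟩)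
  simpa [MulAut.conj_apply] using mem_comap.1 (this hx)

/-- Characters that separate the stable letters from each other and from the base group. -/
structure AscChar {m : ℕ} (ι : K →* G) (t : Fin m → G) (χ : Fin m → G →* ℝ) : Prop where
  base : ∀ j k, χ j (ι k) = 1
  off : ∀ i j, i ≠ j → χ j (t i) = 1
  pos : ∀ j, 0 < χ j (t j)
  ne_one : ∀ j, χ j (t j) ≠ 1

theorem AscChar.castSucc {m : ℕ} {ι : K →* G} {t : Fin (m + 1) → G} {χ : Fin (m + 1) → G →* ℝ}
    (h : AscChar ι t χ) :
    AscChar ι (fun j : Fin m => t j.castSucc) (fun j => χ j.castSucc) :=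
  ⟨fun _ _ => h.base _ _, fun i j hij => h.off _ _ (by simpa using hij), fun _ => h.pos _,
    fun _ => h.ne_one _⟩

theorem AscChar.last_eq_one {m : ℕ} {ι : K →* G} {t : Fin (m + 1) → G}
    {χ : Fin (m + 1) → G →* ℝ} (h : AscChar ι t χ) {x : G}
    (hx : x ∈ ι.range ⊔ closure (Set.range fun j : Fin m => t j.castSucc)) :
    χ (Fin.last m) x = 1 := by
  have : ι.range ⊔ closure (Set.range fun j : Fin m => t j.castSucc) ≤
      (χ (Fin.last m)).ker := by
    refine sup_le ?_ ((closure_le _).2 ?_)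
    · rintro _ ⟨k, rfl⟩
      exact h.base _ _
    · rintro _ ⟨j, rfl⟩
      exact h.off _ _ (Fin.castSucc_lt_last j).ne
  exact this hx

/-- Letters are added one at a time by `eq_one_of_mem_sup_zpowers`. Only the target of `f` has to
carry characters. -/
theorem AscRel.eq_one_of_map_eq_one {m : ℕ} {φ : Fin m → K →* K} {ι : K →* G} {t : Fin m → G}
    (h : AscRel φ ι t) (f : G →* G₁) (hf : Function.Injective (f.comp ι))
    {χ : Fin m → G₁ →* ℝ} (hχ : AscChar (f.comp ι) (fun j => f (t j)) χ)
    {g : G} (hg : g ∈ ι.range ⊔ closure (Set.range t)) (hfg : f g = 1) : g = 1 := by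
  induction m generalizing g with
  | zero =>
    rw [Set.range_eq_empty, Subgroup.closure_empty, sup_bot_eq] at hg
    obtain ⟨k, rfl⟩ := hg
    have : k = 1 := hf (by simpa using hfg)
    rw [this, map_one]
  | succ m ih =>
    rw [closure_range_fin_succ, ← sup_assoc] at hg
    refine eq_one_of_mem_sup_zpowers (fun x hx => h.conj_last_mem hx) f
      (fun x hx hfx => ih h.castSucc hχ.castSucc hx hfx) (χ (Fin.last m)) (fun x hx => ?_)
      (hχ.pos _) (hχ.ne_one _) hg hfg
    refine hχ.last_eq_one ?_
    have := mem_map_of_mem f hx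
    rw [Subgroup.map_sup, MonoidHom.map_range, MonoidHom.map_closure, ← Set.range_comp] at this
    exact this

/-- The pairs of corresponding generators satisfy the same relations in `G × G₁`. Hence the
characters of `G` alone make the projection to `G` injective on the subgroup that they generate. -/
theorem fst_bijective_of_ascRel {m : ℕ} {φ : Fin m → K →* K} {ι : K →* G} {t : Fin m → G}
    {ι' : K →* G₁} {t' : Fin m → G₁} (h : AscRel φ ι t) (h' : AscRel φ ι' t')
    (hι : Function.Injective ι) {χ : Fin m → G →* ℝ} (hχ : AscChar ι t χ)
    (hgen : ι.range ⊔ closure (Set.range t) = ⊤) :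
    Function.Bijective ((MonoidHom.fst G G₁).comp
      ((ι.prod ι').range ⊔ closure (Set.range fun j => (t j, t' j))).subtype) := by
  have hr : AscRel φ (ι.prod ι') (fun j => (t j, t' j)) :=
    ⟨fun i j => Prod.ext (h.comm i j) (h'.comm i j),
      fun j k => Prod.ext (h.conj j k) (h'.conj j k)⟩
  refine ⟨(injective_iff_map_eq_one _).2 fun x hx => Subtype.ext ?_, ?_⟩
  · exact hr.eq_one_of_map_eq_one (MonoidHom.fst G G₁) hι hχ x.2 hx
  · rw [← MonoidHom.range_eq_top, MonoidHom.range_comp, range_subtype, Subgroup.map_sup,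
      MonoidHom.map_range, MonoidHom.map_closure, ← Set.range_comp]
    exact hgen

/-- The subgroup of `G × G₁` generated by the pairs of corresponding generators is the graph of an
isomorphism, as both projections are bijective on it. -/
theorem nonempty_mulEquiv_of_ascRel {m : ℕ} {φ : Fin m → K →* K} {ι : K →* G} {t : Fin m → G}
    {ι' : K →* G₁} {t' : Fin m → G₁} (h : AscRel φ ι t) (h' : AscRel φ ι' t')
    (hι : Function.Injective ι) (hι' : Function.Injective ι')
    {χ : Fin m → G →* ℝ} (hχ : AscChar ι t χ) {χ' : Fin m → G₁ →* ℝ} (hχ' : AscChar ι' t' χ')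
    (hgen : ι.range ⊔ closure (Set.range t) = ⊤)
    (hgen' : ι'.range ⊔ closure (Set.range t') = ⊤) : Nonempty (G ≃* G₁) := by
  have b1 := fst_bijective_of_ascRel h h' hι hχ hgen
  have b2 := fst_bijective_of_ascRel h' h hι' hχ' hgen'
  have hmap : ((ι.prod ι').range ⊔ closure (Set.range fun j => (t j, t' j))).map
      (MulEquiv.prodComm : G × G₁ ≃* G₁ × G).toMonoidHom =
      (ι'.prod ι).range ⊔ closure (Set.range fun j => (t' j, t j)) := by
    rw [Subgroup.map_sup, MonoidHom.map_range, MonoidHom.map_closure, ← Set.range_comp]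
    rfl
  exact ⟨(MulEquiv.ofBijective _ b1).symm.trans ((equivMapOfInjective _ _
    (MulEquiv.injective _)).trans ((MulEquiv.subgroupCongr hmap).trans
      (MulEquiv.ofBijective _ b2)))⟩

end Abstract

/-! ### Recognizing iterated ascending HNN-extensions -/

section Iterated

open Subgroup

universe w

variable {K : Type w} [Group K]

theorem IsIteratedAscHNN.congr {m : ℕ} {G G' : Type w} [Group G] [Group G'] {ι : K →* G}
    {t : Fin m → G} (h : IsIteratedAscHNN K m G ι t) (e : G ≃* G') :
    IsIteratedAscHNN K m G' (e.toMonoidHom.comp ι) (fun j => e (t j)) := by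
  cases h with
  | base _ _ hι => exact .base _ _ (e.bijective.comp hι)
  | step ι₀ t₀ h₀ ψ hψ e' _ _ hι ht hlast =>
    refine .step ι₀ t₀ h₀ ψ hψ (e'.trans e) _ _ (fun k => ?_) (fun i => ?_) ?_
    · simp [hι]
    · simp [ht]
    · simp [hlast]

theorem AscHNN.mem_range_of_sup_zpowers {G : Type w} [Group G] (ψ : G →* G)
    (hψ : Function.Injective ψ) (x : AscHNN ψ hψ) :
    x ∈ (HNNExtension.of : G →* AscHNN ψ hψ).range ⊔ zpowers (HNNExtension.t : AscHNN ψ hψ) := by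
  induction x using HNNExtension.induction_on with
  | of g => exact mem_sup_left ⟨g, rfl⟩
  | t => exact mem_sup_right (mem_zpowers _)
  | mul x y hx hy => exact mul_mem hx hy
  | inv x hx => exact inv_mem hx

/-- A group generated by a subgroup `H` and an element `t` with `t⁻¹ H t ≤ H` is an ascending
HNN-extension if a character separates `t` from `H`. -/
theorem exists_ascHNN_mulEquiv {G : Type w} [Group G] (H : Subgroup G) (t : G)
    (ht : ∀ h ∈ H, t⁻¹ * h * t ∈ H) (hgen : H ⊔ zpowers t = ⊤) (χ : G →* ℝ)
    (hχ : ∀ h ∈ H, χ h = 1) (h0 : 0 < χ t) (h1 : χ t ≠ 1) :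
    ∃ (ψ : H →* H) (hψ : Function.Injective ψ) (e : AscHNN ψ hψ ≃* G),
      (∀ h : H, e (HNNExtension.of h) = h) ∧ e HNNExtension.t = t := by
  let ψ : H →* H := ((MulAut.conj t⁻¹).toMonoidHom.comp H.subtype).codRestrict H
    (fun h => by simpa [MulAut.conj_apply] using ht h h.2)
  have hψ_apply : ∀ h : H, (ψ h : G) = t⁻¹ * h * t := fun h => by
    simp [ψ]
  have hψ : Function.Injective ψ := fun x y hxy => by
    have := congrArg Subtype.val hxy
    rw [hψ_apply, hψ_apply] at this
    exact Subtype.ext (by simpa using this)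
  let f : AscHNN ψ hψ →* G := HNNExtension.lift H.subtype t (by
    rintro ⟨_, y, rfl⟩
    have : (MonoidHom.ofInjective hψ).symm ⟨ψ y, y, rfl⟩ = y := by
      rw [MulEquiv.symm_apply_eq]; rfl
    simp only [MulEquiv.trans_apply, this]
    change t * (ψ y : G) = y * t
    rw [hψ_apply]; group)
  have fof : ∀ h : H, f (HNNExtension.of h) = h := fun h => HNNExtension.lift_of ..
  have ft : f HNNExtension.t = t := HNNExtension.lift_t ..
  refine ⟨ψ, hψ, MulEquiv.ofBijective f ⟨(injective_iff_map_eq_one f).2 fun x hx => ?_, ?_⟩,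
    fof, ft⟩
  -- The criterion is applied inside the HNN-extension, with the image of `H` as the subgroup; the
  -- character is `χ` after `f`.
  · refine eq_one_of_mem_sup_zpowers ?_ f ?_ χ ?_ (by rwa [ft]) (by rwa [ft])
      (AscHNN.mem_range_of_sup_zpowers ψ hψ x) hx
    · rintro _ ⟨g, rfl⟩
      exact ⟨ψ g, (AscHNN.conj_t ψ hψ g).symm⟩
    · rintro _ ⟨g, rfl⟩ hg
      rw [fof] at hg
      rw [show g = 1 from Subtype.ext hg, map_one]
    · rintro _ ⟨g, rfl⟩
      rw [fof]; exact hχ g g.2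
  · rw [← MonoidHom.range_eq_top, eq_top_iff, ← hgen]
    refine sup_le (fun h hh => ⟨HNNExtension.of ⟨h, hh⟩, fof _⟩) ?_
    rw [zpowers_le]
    exact ⟨_, ft⟩

/-- Peel off the last letter: the base and the earlier letters generate a subgroup to which the
induction hypothesis applies with restricted characters. -/
theorem AscRel.isIteratedAscHNN {m : ℕ} {G : Type w} [Group G] {φ : Fin m → K →* K}
    {ι : K →* G} {t : Fin m → G} (h : AscRel φ ι t) (hι : Function.Injective ι)
    {χ : Fin m → G →* ℝ} (hχ : AscChar ι t χ)
    (hgen : ι.range ⊔ closure (Set.range t) = ⊤) : IsIteratedAscHNN K m G ι t := by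
  induction m generalizing G with
  | zero =>
    rw [Set.range_eq_empty, Subgroup.closure_empty, sup_bot_eq, MonoidHom.range_eq_top] at hgen
    exact .base _ _ ⟨hι, hgen⟩
  | succ m ih =>
    rw [closure_range_fin_succ, ← sup_assoc] at hgen
    set H := ι.range ⊔ closure (Set.range fun j : Fin m => t j.castSucc) with hH
    obtain ⟨ψ, hψ, e, he, het⟩ := exists_ascHNN_mulEquiv H (t (Fin.last m))
      (fun x hx => h.conj_last_mem hx) hgen (χ (Fin.last m)) (fun x hx => hχ.last_eq_one hx)
      (hχ.pos _) (hχ.ne_one _)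
    have hιH : ∀ k, ι k ∈ H := fun k => mem_sup_left ⟨k, rfl⟩
    have htH : ∀ j : Fin m, t j.castSucc ∈ H := fun j => mem_sup_right (subset_closure ⟨j, rfl⟩)
    refine .step (ι.codRestrict H hιH) (fun j => ⟨t j.castSucc, htH j⟩) ?_ ψ hψ e _ _
      (fun k => by rw [he]; rfl) (fun i => by rw [he]) het.symm
    refine ih (φ := fun j => φ j.castSucc) ⟨fun i j => Subtype.ext (h.comm _ _),
      fun j k => Subtype.ext (h.conj _ _)⟩
      (fun x y hxy => hι (congrArg Subtype.val hxy)) (χ := fun j => (χ j.castSucc).comp H.subtype)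
      ⟨fun j k => hχ.castSucc.base j k, fun i j hij => hχ.castSucc.off i j hij,
        fun j => hχ.castSucc.pos j, fun j => hχ.castSucc.ne_one j⟩ ?_
    apply map_injective H.subtype_injective
    rw [Subgroup.map_sup, MonoidHom.map_range, MonoidHom.map_closure, ← Set.range_comp,
      ← MonoidHom.range_eq_map, range_subtype]
    exact hH.symm

end Iterated

/-! ### Piecewise linear homeomorphisms of the line -/

section PiecewiseLinear

open Filter Topology Equiv

theorem IsDyadic.intCast (k : ℤ) : IsDyadic k := ⟨k, 0, by simp⟩

theorem IsDyadic.sub {x y : ℝ} (hx : IsDyadic x) (hy : IsDyadic y) : IsDyadic (x - y) := by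
  rw [sub_eq_add_neg]; exact hx.add hy.neg

theorem IsDyadic.one : IsDyadic 1 := ⟨1, 0, by simp⟩

theorem IsDyadic.one_half : IsDyadic (1 / 2) := ⟨1, 1, by norm_num⟩

theorem IsDyadic.one_quarter : IsDyadic (1 / 4) := ⟨1, 2, by norm_num⟩

theorem IsDyadic.three_quarters : IsDyadic (3 / 4) := ⟨3, 2, by norm_num⟩

/-- Piecewise linear functions on the line with finitely many dyadic break points, slopes powers
of `2` and dyadic intercepts: the affine ones, and those obtained by continuous gluing at a dyadic
point. -/
inductive IsPL : (ℝ → ℝ) → Prop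
  | affine (n : ℤ) {c : ℝ} (hc : IsDyadic c) : IsPL (fun x => 2 ^ n * x + c)
  | glue {f g : ℝ → ℝ} {d : ℝ} (hd : IsDyadic d) (hf : IsPL f) (hg : IsPL g) (h : f d = g d) :
      IsPL (fun x => if x ≤ d then f x else g x)

theorem IsPL.congr {f g : ℝ → ℝ} (hf : IsPL f) (h : ∀ x, g x = f x) : IsPL g := by
  rwa [show g = f from funext h]

theorem IsPL.id : IsPL (fun x => x) :=
  (IsPL.affine 0 IsDyadic.zero).congr fun x => by simp

theorem IsPL.strictMono {f : ℝ → ℝ} (hf : IsPL f) : StrictMono f := by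
  induction hf with
  | affine n hc =>
    intro x y hxy
    have : (0 : ℝ) < 2 ^ n := by positivity
    have := mul_lt_mul_of_pos_left hxy this
    dsimp only; linarith
  | @glue f g d hd hf hg h ihf ihg =>
    intro x y hxy
    dsimp only
    split_ifs with h1 h2 h2
    · exact ihf hxy
    · calc f x ≤ f d := ihf.monotone h1
        _ = g d := h
        _ < g y := ihg (not_le.1 h2)
    · exact absurd (hxy.le.trans h2) h1
    · exact ihg hxy

theorem IsPL.map_dyadic {f : ℝ → ℝ} (hf : IsPL f) {x : ℝ} (hx : IsDyadic x) : IsDyadic (f x) := by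
  induction hf with
  | affine n hc => exact (hx.zpow_mul n).add hc
  | glue hd hf hg h ihf ihg => dsimp only; split_ifs <;> assumption

theorem IsPL.comp {f g : ℝ → ℝ} (hf : IsPL f) (hg : IsPL g) : IsPL (fun x => f (g x)) := by
  induction hg with
  | @affine n c hc =>
    have hpos : (0 : ℝ) < 2 ^ n := by positivity
    induction hf with
    | @affine p e he =>
      refine (IsPL.affine (p + n) ((hc.zpow_mul p).add he)).congr fun x => ?_
      rw [zpow_add₀ two_ne_zero]; ring
    | @glue f g d hd hf hg h ihf ihg =>
      -- The break point of the composite is the preimage of `d` under the affine map, again dyadic.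
      have e : ∀ x : ℝ, 2 ^ n * x + c ≤ d ↔ x ≤ 2 ^ (-n) * (d - c) := fun x => by
        rw [zpow_neg, inv_mul_eq_div, le_div_iff₀ hpos, mul_comm x, le_sub_iff_add_le]
      have e' : (2 : ℝ) ^ n * (2 ^ (-n) * (d - c)) + c = d := by
        rw [zpow_neg]; field_simp; ring
      refine (IsPL.glue ((hd.sub hc).zpow_mul (-n)) ihf ihg ?_).congr fun x => ?_
      · dsimp only; rw [e']; exact h
      · simp only [e]
  | glue hd hg₁ hg₂ h ih₁ ih₂ =>
    refine (IsPL.glue hd ih₁ ih₂ (congrArg f h)).congr fun x => ?_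
    dsimp only; split_ifs <;> rfl

theorem IsPL.exists_inverse {f : ℝ → ℝ} (hf : IsPL f) :
    ∃ g, IsPL g ∧ Function.LeftInverse g f ∧ Function.RightInverse g f := by
  induction hf with
  | @affine n c hc =>
    refine ⟨_, IsPL.affine (-n) (hc.zpow_mul (-n)).neg, fun x => ?_, fun x => ?_⟩ <;>
    · rw [zpow_neg]
      have : (2 : ℝ) ^ n ≠ 0 := by positivity
      field_simp; ring
  | @glue f g d hd hf hg h ihf ihg =>
    obtain ⟨f', hf', lf, rf⟩ := ihf
    obtain ⟨g', hg', lg, rg⟩ := ihg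
    refine ⟨_, IsPL.glue (hf.map_dyadic hd) hf' hg' (by rw [lf d, h, lg d]),
      fun x => ?_, fun x => ?_⟩ <;> dsimp only
    · by_cases hx : x ≤ d
      · rw [if_pos hx, if_pos (hf.strictMono.monotone hx), lf]
      · rw [if_neg hx, if_neg, lg]
        rw [h, hg.strictMono.le_iff_le]; exact hx
    · by_cases hx : x ≤ f d
      · have : f' x ≤ d := by rw [← lf d]; exact hf'.strictMono.monotone hx
        rw [if_pos hx, if_pos this, rf]
      · have : ¬ g' x ≤ d := by
          rw [← lg d, hg'.strictMono.le_iff_le, ← h]; exact hx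
        rw [if_neg hx, if_neg this, rg]

theorem IsPL.exists_perm {f : ℝ → ℝ} (hf : IsPL f) : ∃ p : Perm ℝ, ⇑p = f := by
  obtain ⟨g, -, l, r⟩ := hf.exists_inverse
  exact ⟨⟨f, g, l, r⟩, rfl⟩

theorem IsPL.perm_inv {p : Perm ℝ} (hp : IsPL p) : IsPL (p⁻¹ : Perm ℝ) := by
  obtain ⟨g, hg, l, r⟩ := hp.exists_inverse
  exact hg.congr fun x => by rw [Perm.inv_eq_iff_eq, r x]

theorem IsPL.perm_mul {p q : Perm ℝ} (hp : IsPL p) (hq : IsPL q) : IsPL (p * q : Perm ℝ) :=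
  hp.comp hq

/-- The group of all piecewise linear homeomorphisms of the line. -/
def PL : Subgroup (Perm ℝ) where
  carrier := {p | IsPL p}
  mul_mem' := fun hp hq => hp.perm_mul hq
  one_mem' := IsPL.id
  inv_mem' := fun hp => hp.perm_inv

theorem mem_PL {p : Perm ℝ} : p ∈ PL ↔ IsPL p := Iff.rfl

theorem strictMono_of_mem_PL {p : Perm ℝ} (hp : p ∈ PL) : StrictMono p := IsPL.strictMono hp

theorem exists_glue {p q : Perm ℝ} (hp : p ∈ PL) (hq : q ∈ PL) {d : ℝ} (hd : IsDyadic d)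
    (h : p d = q d) :
    ∃ r ∈ PL, (∀ x ≤ d, r x = p x) ∧ ∀ x, d ≤ x → r x = q x := by
  have hr := IsPL.glue hd hp hq h
  obtain ⟨r, hr'⟩ := hr.exists_perm
  refine ⟨r, by rw [mem_PL, hr']; exact hr, fun x hx => by rw [hr']; simp [hx], fun x hx => ?_⟩
  rw [hr']
  dsimp only
  split_ifs with hx'
  · rw [le_antisymm hx' hx, h]
  · rfl

theorem exists_affine (n : ℤ) {c : ℝ} (hc : IsDyadic c) :
    ∃ p ∈ PL, ∀ x, p x = 2 ^ n * x + c := by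
  obtain ⟨p, hp⟩ := (IsPL.affine n hc).exists_perm
  exact ⟨p, by rw [mem_PL, hp]; exact .affine n hc, fun x => by rw [hp]⟩

/-- Gluing happens only at dyadic points, so a non-dyadic point lies in the interior of an affine
piece. -/
theorem IsPL.eventually_affine {f : ℝ → ℝ} (hf : IsPL f) {x : ℝ} (hx : ¬ IsDyadic x) :
    ∃ (n : ℤ) (c : ℝ), IsDyadic c ∧ ∀ᶠ y in 𝓝 x, f y = 2 ^ n * y + c := by
  induction hf with
  | @affine n c hc => exact ⟨n, c, hc, .of_forall fun _ => rfl⟩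
  | @glue f g d hd hf hg h ihf ihg =>
    rcases lt_trichotomy x d with hxd | rfl | hxd
    · obtain ⟨n, c, hc, H⟩ := ihf
      refine ⟨n, c, hc, ?_⟩
      filter_upwards [H, eventually_lt_nhds hxd] with y hy hyd
      rw [if_pos hyd.le, hy]
    · exact absurd hd hx
    · obtain ⟨n, c, hc, H⟩ := ihg
      refine ⟨n, c, hc, ?_⟩
      filter_upwards [H, eventually_gt_nhds hxd] with y hy hyd
      rw [if_neg (not_le.2 hyd), hy]

theorem IsPL.exists_breakpoints {f : ℝ → ℝ} (hf : IsPL f) :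
    ∃ D : Finset ℝ, (∀ d ∈ D, IsDyadic d) ∧ ∀ a b : ℝ, (∀ d ∈ D, ¬ (a < d ∧ d < b)) →
      ∃ (n : ℤ) (c : ℝ), ∀ x, a ≤ x → x ≤ b → f x = 2 ^ n * x + c := by
  classical
  induction hf with
  | @affine n c hc => exact ⟨∅, by simp, fun a b _ => ⟨n, c, fun _ _ _ => rfl⟩⟩
  | @glue f g d hd hf hg h ihf ihg =>
    obtain ⟨D, hD, H⟩ := ihf
    obtain ⟨E, hE, K⟩ := ihg
    refine ⟨insert d (D ∪ E), ?_, fun a b hfree => ?_⟩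
    · simp only [Finset.mem_insert, Finset.mem_union]
      rintro e (rfl | he | he)
      exacts [hd, hD e he, hE e he]
    · rcases le_or_gt b d with hb | hb
      · obtain ⟨n, c, hc⟩ := H a b fun e he => hfree e (by simp [he])
        exact ⟨n, c, fun x h1 h2 => by dsimp only; rw [if_pos (h2.trans hb), hc x h1 h2]⟩
      · have ha : d ≤ a := not_lt.1 fun h' => hfree d (by simp) ⟨h', hb⟩
        obtain ⟨n, c, hc⟩ := K a b fun e he => hfree e (by simp [he])
        refine ⟨n, c, fun x h1 h2 => ?_⟩
        dsimp only
        split_ifs with hx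
        · rw [← hc x h1 h2, le_antisymm hx (ha.trans h1), h]
        · exact hc x h1 h2

/-- Induction on the number of break points to the left of `x`: the map is built from left to right
by gluing an affine piece at the last break point before `x`. -/
theorem IsPLDyadic.exists_isPL {f : I ≃o I} (hf : IsPLDyadic f) :
    ∃ g : ℝ → ℝ, IsPL g ∧ ∀ x : I, g x = f x := by
  have hmap := hf.map_dyadic
  obtain ⟨D, hD, h⟩ := hf
  have hbot : f ⊥ = ⊥ := f.map_bot
  have hb0 : ((⊥ : I) : ℝ) = 0 := rfl
  have extend : ∀ a x : I, a < x → (∀ d ∈ D, ¬ ((a : ℝ) < d ∧ d < x)) → IsDyadic a →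
      (∃ g : ℝ → ℝ, IsPL g ∧ ∀ y ≤ a, g y = f y) →
      ∃ g : ℝ → ℝ, IsPL g ∧ ∀ y ≤ x, g y = f y := by
    rintro a x hax hfree ha ⟨g, hg, hgf⟩
    obtain ⟨n, c, hc⟩ := h a x hax hfree
    have h1 := hc a le_rfl hax.le
    -- `IsPL` asks for dyadic intercepts; this one is dyadic because both `a` and `f a` are.
    have hcd : IsDyadic c := by
      have : c = f a - 2 ^ n * a := by rw [h1]; ring
      rw [this]
      exact (hmap a ha).sub (ha.zpow_mul n)
    refine ⟨_, IsPL.glue ha hg (.affine n hcd) (by rw [hgf a le_rfl, h1]), fun y hy => ?_⟩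
    by_cases hya : y ≤ a
    · rw [if_pos (by exact hya), hgf y hya]
    · rw [if_neg (by exact hya), hc y (le_of_not_ge hya) hy]
  have start : ∃ g : ℝ → ℝ, IsPL g ∧ ∀ y ≤ (⊥ : I), g y = f y := by
    refine ⟨_, IsPL.id, fun y hy => ?_⟩
    rw [le_bot_iff.1 hy, hbot]
  suffices H : ∀ (N : ℕ) (x : I), (D.filter (fun d => d < (x : ℝ))).card ≤ N →
      ∃ g : ℝ → ℝ, IsPL g ∧ ∀ y ≤ x, g y = f y by
    obtain ⟨g, hg, hgf⟩ := H _ ⊤ le_rfl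
    exact ⟨g, hg, fun x => hgf x le_top⟩
  intro N
  induction N with
  | zero =>
    intro x hN
    have hemp : D.filter (fun d => d < (x : ℝ)) = ∅ := Finset.card_eq_zero.1 (by omega)
    rcases eq_or_lt_of_le (bot_le : (⊥ : I) ≤ x) with h0 | h0
    · rw [← h0]; exact start
    · refine extend ⊥ x h0 (fun d hd hlt => ?_) IsDyadic.zero start
      exact Finset.notMem_empty d (hemp ▸ Finset.mem_filter.2 ⟨hd, hlt.2⟩)
  | succ N ih =>
    intro x hN
    rcases eq_or_lt_of_le (bot_le : (⊥ : I) ≤ x) with h0 | h0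
    · rw [← h0]; exact start
    by_cases hne : (D.filter (fun d => 0 < d ∧ d < (x : ℝ))).Nonempty
    · have hm := Finset.mem_filter.1 (Finset.max'_mem _ hne)
      have hmax : ∀ d ∈ D.filter (fun d => 0 < d ∧ d < (x : ℝ)),
          d ≤ (D.filter (fun d => 0 < d ∧ d < (x : ℝ))).max' hne := fun d hd =>
        Finset.le_max' _ d hd
      generalize (D.filter (fun d => 0 < d ∧ d < (x : ℝ))).max' hne = a at hm hmax
      let a' : I := ⟨a, hm.2.1.le, hm.2.2.le.trans x.2.2⟩
      refine extend a' x hm.2.2 (fun d hd hlt => ?_) (hD a hm.1) (ih a' ?_)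
      · exact absurd (hmax d (Finset.mem_filter.2 ⟨hd, hm.2.1.trans hlt.1, hlt.2⟩))
          (not_le.2 hlt.1)
      · refine Nat.le_of_lt_succ (lt_of_lt_of_le (Finset.card_lt_card
          ((Finset.ssubset_iff_of_subset ?_).2 ⟨a, Finset.mem_filter.2 ⟨hm.1, hm.2.2⟩, ?_⟩)) hN)
        · exact Finset.monotone_filter_right _ fun d _ hd => lt_trans hd hm.2.2
        · exact fun hc => lt_irrefl _ (Finset.mem_filter.1 hc).2
    · refine extend ⊥ x h0 (fun d hd hlt => hne ⟨d, ?_⟩) IsDyadic.zero start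
      exact Finset.mem_filter.2 ⟨hd, hlt⟩

end PiecewiseLinear

/-! ### Transitivity -/

section Transitivity

open Equiv

theorem exists_mem_PL_natCast (k l : ℕ) :
    ∃ p ∈ PL, p 0 = 0 ∧ p ((k + 1 : ℕ) : ℝ) = (l + 1 : ℕ) := by
  have base : ∀ k : ℕ, ∃ p ∈ PL, p 0 = 0 ∧ p ((0 + 1 : ℕ) : ℝ) = (k + 1 : ℕ) := by
    intro k
    induction k with
    | zero => exact ⟨1, PL.one_mem, rfl, rfl⟩
    | succ k ih =>
      obtain ⟨p, hp, h0, h1⟩ := ih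
      -- The map `x ↦ 2 * x - k` fixes `k` and sends `k + 1` to `k + 2`: doubling the last unit
      -- interval lengthens `[0, k + 1]` by one.
      obtain ⟨a, ha, hax⟩ := exists_affine 1 (IsDyadic.intCast (-k))
      obtain ⟨r, hr, hr1, hr2⟩ := exists_glue (PL.one_mem) ha (IsDyadic.intCast k)
        (by rw [hax]; push_cast; simp; ring)
      refine ⟨r * p, PL.mul_mem hr hp, ?_, ?_⟩
      · rw [Perm.mul_apply, h0, hr1 _ (by simp)]; rfl
      · rw [Perm.mul_apply, h1, hr2 _ (by push_cast; linarith), hax]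
        push_cast; ring
  obtain ⟨p, hp, hp0, hp1⟩ := base k
  obtain ⟨q, hq, hq0, hq1⟩ := base l
  refine ⟨q * p⁻¹, PL.mul_mem hq (PL.inv_mem hp), ?_, ?_⟩
  · rw [Perm.mul_apply, Perm.inv_eq_iff_eq.2 hp0.symm, hq0]
  · rw [Perm.mul_apply, Perm.inv_eq_iff_eq.2 hp1.symm, hq1]

theorem exists_mem_PL_of_pos {c d : ℝ} (hc : IsDyadic c) (hd : IsDyadic d) (hc0 : 0 < c)
    (hd0 : 0 < d) : ∃ p ∈ PL, p 0 = 0 ∧ p c = d := by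
  -- Multiplying by a power of `2` clears the denominator, which reduces to positive integers.
  have key : ∀ c, IsDyadic c → 0 < c → ∃ (k : ℕ), ∃ p ∈ PL, p 0 = 0 ∧ p c = (k + 1 : ℕ) := by
    rintro c ⟨k, n, rfl⟩ h0
    have hk : 0 < k := by
      have : (0 : ℝ) < k := (div_pos_iff_of_pos_right (by positivity)).1 h0
      exact_mod_cast this
    obtain ⟨a, ha, hax⟩ := exists_affine n IsDyadic.zero
    refine ⟨(k - 1).toNat, a, ha, by rw [hax]; simp, ?_⟩
    have e : (((k - 1).toNat + 1 : ℕ) : ℝ) = k := by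
      have : (((k - 1).toNat + 1 : ℕ) : ℤ) = k := by push_cast; omega
      exact_mod_cast this
    rw [hax, e, zpow_natCast]
    field_simp; ring
  obtain ⟨k, p, hp, hp0, hp1⟩ := key c hc hc0
  obtain ⟨l, q, hq, hq0, hq1⟩ := key d hd hd0
  obtain ⟨r, hr, hr0, hr1⟩ := exists_mem_PL_natCast k l
  refine ⟨q⁻¹ * (r * p), PL.mul_mem (PL.inv_mem hq) (PL.mul_mem hr hp), ?_, ?_⟩
  · rw [Perm.mul_apply, Perm.mul_apply, hp0, hr0, Perm.inv_eq_iff_eq, hq0]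
  · rw [Perm.mul_apply, Perm.mul_apply, hp1, hr1, Perm.inv_eq_iff_eq, hq1]

theorem exists_mem_PL_pair {a b c d : ℝ} (ha : IsDyadic a) (hb : IsDyadic b) (hc : IsDyadic c)
    (hd : IsDyadic d) (hab : a < b) (hcd : c < d) : ∃ p ∈ PL, p a = c ∧ p b = d := by
  obtain ⟨p, hp, hp0, hp1⟩ :=
    exists_mem_PL_of_pos (hb.sub ha) (hd.sub hc) (sub_pos.2 hab) (sub_pos.2 hcd)
  obtain ⟨s, hs, hsx⟩ := exists_affine 0 ha.neg
  obtain ⟨t, ht, htx⟩ := exists_affine 0 hc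
  refine ⟨t * (p * s), PL.mul_mem ht (PL.mul_mem hp hs), ?_, ?_⟩
  · rw [Perm.mul_apply, Perm.mul_apply, hsx, htx, zpow_zero, one_mul, one_mul, add_neg_cancel,
      hp0, zero_add]
  · rw [Perm.mul_apply, Perm.mul_apply, hsx, htx, zpow_zero, one_mul, one_mul, ← sub_eq_add_neg,
      hp1, sub_add_cancel]

/-- Three maps of consecutive intervals glued at `a₂` and `a₃`. Four marked points are what a frame
needs: the ends of `[0,1]` and their images `1/4` and `3/4` under the two contractions. -/
theorem exists_mem_PL_four {a₁ a₂ a₃ a₄ b₁ b₂ b₃ b₄ : ℝ} (ha₁ : IsDyadic a₁) (ha₂ : IsDyadic a₂)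
    (ha₃ : IsDyadic a₃) (ha₄ : IsDyadic a₄) (hb₁ : IsDyadic b₁) (hb₂ : IsDyadic b₂)
    (hb₃ : IsDyadic b₃) (hb₄ : IsDyadic b₄) (h₁ : a₁ < a₂) (h₂ : a₂ < a₃) (h₃ : a₃ < a₄)
    (k₁ : b₁ < b₂) (k₂ : b₂ < b₃) (k₃ : b₃ < b₄) :
    ∃ p ∈ PL, p a₁ = b₁ ∧ p a₂ = b₂ ∧ p a₃ = b₃ ∧ p a₄ = b₄ := by
  obtain ⟨p, hp, p₁, p₂⟩ := exists_mem_PL_pair ha₁ ha₂ hb₁ hb₂ h₁ k₁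
  obtain ⟨q, hq, q₂, q₃⟩ := exists_mem_PL_pair ha₂ ha₃ hb₂ hb₃ h₂ k₂
  obtain ⟨r, hr, r₃, r₄⟩ := exists_mem_PL_pair ha₃ ha₄ hb₃ hb₄ h₃ k₃
  obtain ⟨s, hs, s₁, s₂⟩ := exists_glue hq hr ha₃ (q₃.trans r₃.symm)
  obtain ⟨t, ht, t₁, t₂⟩ := exists_glue hp hs ha₂ (by rw [p₂, s₁ _ h₂.le, q₂])
  exact ⟨t, ht, by rw [t₁ _ h₁.le, p₁], by rw [t₁ _ le_rfl, p₂],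
    by rw [t₂ _ h₂.le, s₁ _ le_rfl, q₃], by rw [t₂ _ (h₂.trans h₃).le, s₂ _ h₃.le, r₄]⟩

end Transitivity

/-! ### Elements of `F` as homeomorphisms of the line -/

section Extension

open Equiv

/-- The action of `F` on the line from the left, by the inverses of its elements extended by the
identity outside `[0,1]`. -/
def ext : F →* Perm ℝ :=
  (Perm.ofSubtype (p := fun x : ℝ => x ∈ Set.Icc (0 : ℝ) 1)).comp
    { toFun := fun f => (f.1.unop).symm.toEquiv
      map_one' := rfl
      map_mul' := fun _ _ => rfl }

theorem ext_apply (f : F) (x : I) : ext f x = F.val f⁻¹ x :=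
  Perm.ofSubtype_apply_coe _ x

theorem ext_inv_apply (f : F) (x : I) : (ext f)⁻¹ x = F.val f x := by
  rw [← map_inv, ext_apply, inv_inv]

theorem ext_apply_of_notMem (f : F) {x : ℝ} (hx : x ∉ Set.Icc (0 : ℝ) 1) : ext f x = x :=
  Perm.ofSubtype_apply_of_not_mem _ hx

theorem F.eq_of_val_eq {f g : F} (h : ∀ x, F.val f x = F.val g x) : f = g :=
  Subtype.ext (MulOpposite.unop_injective (OrderIso.ext (funext h)))

theorem ext_injective : Function.Injective ext := by
  refine (injective_iff_map_eq_one _).2 fun f hf => F.eq_of_val_eq fun x => Subtype.ext ?_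
  rw [← ext_inv_apply, hf]; rfl

theorem ext_mem_PL (f : F) : ext f ∈ PL := by
  obtain ⟨g, hg, hgf⟩ := IsPLDyadic.exists_isPL (f⁻¹).2
  obtain ⟨p, hp⟩ := hg.exists_perm
  have hp' : p ∈ PL := by rw [mem_PL, hp]; exact hg
  have hpf : ∀ x : I, p x = F.val f⁻¹ x := fun x => by rw [hp, hgf]; rfl
  have h0 : F.val f⁻¹ ⊥ = ⊥ := (f⁻¹).1.unop.map_bot
  have h1 : F.val f⁻¹ ⊤ = ⊤ := (f⁻¹).1.unop.map_top
  obtain ⟨q, hq, q₁, q₂⟩ := exists_glue hp' PL.one_mem IsDyadic.one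
    (by have := hpf ⊤; rw [h1] at this; exact this)
  obtain ⟨r, hr, r₁, r₂⟩ := exists_glue PL.one_mem hq IsDyadic.zero
    (by rw [q₁ _ zero_le_one]; have := hpf ⊥; rw [h0] at this; exact this.symm)
  have : ext f = r := by
    ext x
    rcases le_total x 0 with hx0 | hx0
    · rw [r₁ x hx0]
      rcases hx0.eq_or_lt with rfl | hx0
      · have := ext_apply f ⊥
        rwa [h0] at this
      · exact ext_apply_of_notMem f fun h => absurd h.1 (not_le.2 hx0)
    rw [r₂ x hx0]
    rcases le_total x 1 with hx1 | hx1
    · rw [q₁ x hx1, ext_apply f ⟨x, hx0, hx1⟩, ← hpf]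
    rw [q₂ x hx1]
    rcases hx1.eq_or_lt with rfl | hx1
    · have := ext_apply f ⊤
      rwa [h1] at this
    · exact ext_apply_of_notMem f fun h => absurd h.2 (not_le.2 hx1)
  rw [this]; exact hr

theorem apply_mem_of_fix_compl {p : Perm ℝ} {S : Set ℝ} (hp : ∀ x ∉ S, p x = x) {x : ℝ}
    (hx : x ∈ S) : p x ∈ S := by
  by_contra h
  exact h (by rwa [p.injective (hp _ h)])

theorem inv_fix {p : Perm ℝ} {x : ℝ} (hp : p x = x) : p⁻¹ x = x := by
  rw [Perm.inv_eq_iff_eq, hp]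

theorem exists_ext_eq {p : Perm ℝ} (hp : p ∈ PL) (h : ∀ x ∉ Set.Icc (0 : ℝ) 1, p x = x) :
    ∃ f : F, ext f = p := by
  have hi : ∀ x ∉ Set.Icc (0 : ℝ) 1, p⁻¹ x = x := fun x hx => inv_fix (h x hx)
  let f : I ≃o I :=
    { toFun := fun x => ⟨p⁻¹ x, apply_mem_of_fix_compl hi x.2⟩
      invFun := fun x => ⟨p x, apply_mem_of_fix_compl h x.2⟩
      left_inv := fun x => by simp
      right_inv := fun x => by simp
      map_rel_iff' := fun {x y} => (strictMono_of_mem_PL (PL.inv_mem hp)).le_iff_le }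
  have hf : IsPLDyadic f := by
    obtain ⟨D, hD, H⟩ := IsPL.exists_breakpoints (PL.inv_mem hp)
    refine ⟨D, hD, fun a b _ hfree => ?_⟩
    obtain ⟨n, c, hc⟩ := H a b hfree
    exact ⟨n, c, fun x h1 h2 => hc x h1 h2⟩
  refine ⟨⟨MulOpposite.op f, hf⟩, ?_⟩
  ext x
  by_cases hx : x ∈ Set.Icc (0 : ℝ) 1
  · exact ext_apply _ ⟨x, hx⟩
  · rw [ext_apply_of_notMem _ hx, h x hx]

end Extension

/-! ### Two contracting endomorphisms of `F` -/

section Contractions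

open Equiv

/-- The contraction of `[0,1]` onto `[1/4,1]`, extended to the line. -/
def shrinkLeft : Perm ℝ where
  toFun x := if x ≤ 1 / 2 then x / 2 + 1 / 4 else x
  invFun x := if x ≤ 1 / 2 then 2 * x - 1 / 2 else x
  left_inv x := by dsimp only; split_ifs <;> linarith
  right_inv x := by dsimp only; split_ifs <;> linarith

/-- The contraction of `[0,1]` onto `[0,3/4]`, extended to the line. -/
def shrinkRight : Perm ℝ where
  toFun x := if x ≤ 1 / 2 then x else x / 2 + 1 / 4
  invFun x := if x ≤ 1 / 2 then x else 2 * x - 1 / 2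
  left_inv x := by dsimp only; split_ifs <;> linarith
  right_inv x := by dsimp only; split_ifs <;> linarith

theorem shrinkLeft_apply (x : ℝ) : shrinkLeft x = if x ≤ 1 / 2 then x / 2 + 1 / 4 else x := rfl

theorem shrinkRight_apply (x : ℝ) : shrinkRight x = if x ≤ 1 / 2 then x else x / 2 + 1 / 4 := rfl

theorem isPL_div_two_add : IsPL (fun x => x / 2 + 1 / 4) :=
  (IsPL.affine (-1) IsDyadic.one_quarter).congr fun x => by rw [zpow_neg_one]; ring

theorem shrinkLeft_mem_PL : shrinkLeft ∈ PL :=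
  IsPL.glue IsDyadic.one_half isPL_div_two_add IsPL.id (by norm_num)

theorem shrinkRight_mem_PL : shrinkRight ∈ PL :=
  IsPL.glue IsDyadic.one_half IsPL.id isPL_div_two_add (by norm_num)

theorem shrinkLeft_mem_Icc {x : ℝ} (hx : x ∈ Set.Icc (0 : ℝ) 1) :
    shrinkLeft x ∈ Set.Icc (0 : ℝ) 1 := by
  rw [shrinkLeft_apply]
  obtain ⟨h0, h1⟩ := hx
  split_ifs <;> constructor <;> linarith

theorem shrinkRight_mem_Icc {x : ℝ} (hx : x ∈ Set.Icc (0 : ℝ) 1) :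
    shrinkRight x ∈ Set.Icc (0 : ℝ) 1 := by
  rw [shrinkRight_apply]
  obtain ⟨h0, h1⟩ := hx
  split_ifs <;> constructor <;> linarith

theorem conj_apply_apply (s q : Perm ℝ) (x : ℝ) : (s * q * s⁻¹) (s x) = s (q x) := by
  simp [Perm.mul_apply]

theorem conj_fix {s q : Perm ℝ} {S : Set ℝ} (hq : ∀ x ∉ S, q x = x) {y : ℝ}
    (hy : ∀ x ∈ S, s x ≠ y) : (s * q * s⁻¹) y = y := by
  obtain ⟨x, rfl⟩ := s.surjective y
  rw [conj_apply_apply, hq x fun h => hy x h rfl]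

/-- A conjugate of `q` depends only on the values of the conjugator on a set supporting `q`. So a
stable letter may be replaced by a model of it on one complementary interval. -/
theorem conj_eq_conj_of_eqOn {s s' q : Perm ℝ} {S : Set ℝ} (hq : ∀ x ∉ S, q x = x)
    (h : ∀ x ∈ S, s x = s' x) : s * q * s⁻¹ = s' * q * s'⁻¹ := by
  ext y
  obtain ⟨x, rfl⟩ := s.surjective y
  by_cases hx : x ∈ S
  · rw [conj_apply_apply, h x hx, conj_apply_apply, h _ (apply_mem_of_fix_compl hq hx)]
  · rw [conj_apply_apply, hq x hx, conj_fix hq]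
    intro z hz e
    rw [← h z hz] at e
    have := s.injective e
    subst this
    exact hx hz

theorem ext_apply_of_notMem_Icc (f : F) : ∀ x ∉ Set.Icc (0 : ℝ) 1, ext f x = x :=
  fun _ => ext_apply_of_notMem f

theorem exists_ext_eq_conj {s : Perm ℝ} (hs : s ∈ PL)
    (hI : ∀ x ∈ Set.Icc (0 : ℝ) 1, s x ∈ Set.Icc (0 : ℝ) 1) (f : F) :
    ∃ f' : F, ext f' = s * ext f * s⁻¹ :=
  exists_ext_eq (PL.mul_mem (PL.mul_mem hs (ext_mem_PL f)) (PL.inv_mem hs)) fun _ hx =>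
    conj_fix (ext_apply_of_notMem_Icc f) fun _ hz e => hx (e ▸ hI _ hz)

/-- The endomorphism of `F` given by conjugation with a piecewise linear embedding of `[0,1]` into
itself. -/
def conjEnd (s : Perm ℝ) (hs : s ∈ PL)
    (hI : ∀ x ∈ Set.Icc (0 : ℝ) 1, s x ∈ Set.Icc (0 : ℝ) 1) : F →* F :=
  (MonoidHom.ofInjective ext_injective).symm.toMonoidHom.comp
    (((MulAut.conj s).toMonoidHom.comp ext).codRestrict ext.range
      fun f => exists_ext_eq_conj hs hI f)

theorem ext_conjEnd {s : Perm ℝ} {hs : s ∈ PL}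
    {hI : ∀ x ∈ Set.Icc (0 : ℝ) 1, s x ∈ Set.Icc (0 : ℝ) 1} (f : F) :
    ext (conjEnd s hs hI f) = s * ext f * s⁻¹ :=
  MonoidHom.apply_ofInjective_symm ext_injective _

theorem conjEnd_eq_of_val {s : Perm ℝ} {hs : s ∈ PL}
    {hI : ∀ x ∈ Set.Icc (0 : ℝ) 1, s x ∈ Set.Icc (0 : ℝ) 1} {f g : F}
    (h : ∀ x : I, (F.val g ⟨s x, hI x x.2⟩ : ℝ) = s (F.val f x))
    (h' : ∀ y : I, (∀ x ∈ Set.Icc (0 : ℝ) 1, s x ≠ y) → F.val g y = y) :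
    conjEnd s hs hI f = g := by
  -- `ext` lets elements act through their inverses, so the pointwise hypotheses speak directly
  -- about `f⁻¹` and `g⁻¹`.
  have key : conjEnd s hs hI f⁻¹ = g⁻¹ := by
    apply ext_injective
    rw [ext_conjEnd]
    ext y
    by_cases hy : y ∈ Set.Icc (0 : ℝ) 1
    · by_cases hys : ∃ x ∈ Set.Icc (0 : ℝ) 1, s x = y
      · obtain ⟨x, hx, rfl⟩ := hys
        rw [conj_apply_apply, ext_apply f⁻¹ ⟨x, hx⟩, inv_inv, ← h, ext_apply g⁻¹ ⟨s x, hI x hx⟩,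
          inv_inv]
      · push Not at hys
        rw [conj_fix (ext_apply_of_notMem_Icc _) hys, ext_apply g⁻¹ ⟨y, hy⟩, inv_inv,
          h' ⟨y, hy⟩ hys]
    · rw [conj_fix (ext_apply_of_notMem_Icc _) fun x hx e => hy (by rw [← e]; exact hI x hx),
        ext_apply_of_notMem_Icc _ _ hy]
  rw [map_inv] at key
  exact inv_injective key

/-- The endomorphism of `F` induced by `shrinkLeft`. -/
def endLeft : F →* F := conjEnd shrinkLeft shrinkLeft_mem_PL fun _ => shrinkLeft_mem_Icc

/-- The endomorphism of `F` induced by `shrinkRight`. -/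
def endRight : F →* F := conjEnd shrinkRight shrinkRight_mem_PL fun _ => shrinkRight_mem_Icc

theorem val_x0 (x : I) : (F.val x0 x : ℝ) = x0Fun x := rfl

theorem val_x1 (x : I) : (F.val x1 x : ℝ) = x1Fun x := rfl

theorem val_x0_inv (x : I) : (F.val x0⁻¹ x : ℝ) = x0Inv x := rfl

theorem val_x1_inv (x : I) : (F.val x1⁻¹ x : ℝ) = x1Inv x := rfl

theorem val_x2 {x : ℝ} (hx : x ∈ Set.Icc (0 : ℝ) 1) : (F.val x2 ⟨x, hx⟩ : ℝ) =
    if x ≤ 3 / 4 then x else if x ≤ 13 / 16 then 2 * x - 3 / 4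
    else if x ≤ 7 / 8 then x + 1 / 16 else x / 2 + 1 / 2 := by
  rw [x2, F.val_mul, F.val_mul, val_x0, val_x1, val_x0_inv]
  have : x1Fun (x0Inv x) = if x ≤ 1 / 2 then x / 2 else if x ≤ 3 / 4 then x - 1 / 4
      else if x ≤ 13 / 16 then 4 * x - 5 / 2 else if x ≤ 7 / 8 then 2 * x - 7 / 8 else x := by
    unfold x0Inv x1Fun
    split_ifs <;> linarith
  rw [this]
  unfold x0Fun
  split_ifs <;> linarith

theorem x1Fun_x1Fun (x : ℝ) : x1Fun (x1Fun x) =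
    if x ≤ 1 / 2 then x else if x ≤ 9 / 16 then 4 * x - 3 / 2
    else if x ≤ 5 / 8 then 2 * x - 3 / 8 else if x ≤ 3 / 4 then x / 2 + 9 / 16
    else x / 4 + 3 / 4 := by
  unfold x1Fun
  split_ifs <;> linarith

/-- Computing inverses is avoided: the value `z` at `x` is characterized by `x1 * x2` taking at `z`
the value that `x1 ^ 2` takes at `x`. -/
theorem val_x1_sq_x2_inv_x1_inv {x : ℝ} (hx : x ∈ Set.Icc (0 : ℝ) 1) :
    (F.val (x1 ^ 2 * x2⁻¹ * x1⁻¹) ⟨x, hx⟩ : ℝ) =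
    if x ≤ 1 / 2 then x else if x ≤ 9 / 16 then 2 * x - 1 / 2
    else if x ≤ 5 / 8 then x + 1 / 16 else if x ≤ 3 / 4 then x / 2 + 3 / 8
    else x := by
  obtain ⟨z, hz⟩ : ∃ z, z = if x ≤ 1 / 2 then x else if x ≤ 9 / 16 then 2 * x - 1 / 2
    else if x ≤ 5 / 8 then x + 1 / 16 else if x ≤ 3 / 4 then x / 2 + 3 / 8
    else x := ⟨_, rfl⟩
  rw [← hz]
  have hzI : z ∈ Set.Icc (0 : ℝ) 1 := by
    obtain ⟨h0, h1⟩ := hx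
    rw [hz]; split_ifs <;> constructor <;> linarith
  have hx1 : x1Fun z = if x ≤ 1 / 2 then x else if x ≤ 9 / 16 then 4 * x - 3 / 2
      else if x ≤ 5 / 8 then x + 3 / 16 else x / 2 + 1 / 2 := by
    rw [hz]; unfold x1Fun
    split_ifs <;> linarith
  obtain ⟨y, hy⟩ : ∃ y, y = x1Fun z := ⟨_, rfl⟩
  have hyI : y ∈ Set.Icc (0 : ℝ) 1 := hy ▸ (F.val x1 ⟨z, hzI⟩).2
  have e : F.val (x1 * x2) ⟨z, hzI⟩ = F.val (x1 ^ 2) ⟨x, hx⟩ := by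
    have ez : F.val x1 ⟨z, hzI⟩ = ⟨y, hyI⟩ := Subtype.ext hy.symm
    apply Subtype.ext
    rw [F.val_mul, ez, val_x2, pow_two, F.val_mul, val_x1, val_x1, x1Fun_x1Fun, hy, hx1]
    split_ifs <;> linarith
  have : F.val (x1 ^ 2 * x2⁻¹ * x1⁻¹) ⟨x, hx⟩ = ⟨z, hzI⟩ := by
    rw [mul_assoc, ← mul_inv_rev, F.val_mul, ← e, ← F.val_mul, mul_inv_cancel, F.val_one]
  rw [this]

theorem val_x0_x1_x0_inv {x : ℝ} (hx : x ∈ Set.Icc (0 : ℝ) 1) :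
    (F.val (x0 * x1 * x0⁻¹) ⟨x, hx⟩ : ℝ) =
    if x ≤ 1 / 4 then x else if x ≤ 1 / 2 then 2 * x - 1 / 4 else x / 2 + 1 / 2 := by
  rw [F.val_mul, F.val_mul, val_x0_inv, val_x1, val_x0]
  have : x1Fun (x0Fun x) = if x ≤ 3 / 8 then 2 * x else if x ≤ 1 / 2 then x + 3 / 8
      else x / 4 + 3 / 4 := by
    unfold x1Fun x0Fun
    split_ifs <;> linarith
  rw [this]
  unfold x0Inv
  split_ifs <;> linarith

theorem val_x0_x1_inv {x : ℝ} (hx : x ∈ Set.Icc (0 : ℝ) 1) :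
    (F.val (x0 * x1⁻¹) ⟨x, hx⟩ : ℝ) =
    if x ≤ 1 / 4 then 2 * x else if x ≤ 3 / 4 then x / 2 + 3 / 8 else x := by
  rw [F.val_mul, val_x1_inv, val_x0]
  unfold x1Inv x0Fun
  split_ifs <;> linarith

theorem endLeft_x0 : endLeft x0 = x0 * x1 * x0⁻¹ := by
  refine conjEnd_eq_of_val (fun x => ?_) (fun y hy => Subtype.ext ?_)
  · obtain ⟨h0, h1⟩ := x.2
    rw [val_x0_x1_x0_inv, val_x0, shrinkLeft_apply, shrinkLeft_apply]
    unfold x0Fun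
    split_ifs <;> linarith
  · rw [val_x0_x1_x0_inv, if_pos]
    by_contra! h
    have h1 := y.2.2
    rcases le_or_gt (y : ℝ) (1 / 2) with h2 | h2
    · refine hy (2 * y - 1 / 2) ⟨by linarith, by linarith⟩ ?_
      rw [shrinkLeft_apply, if_pos (by linarith)]; ring
    · refine hy y y.2 ?_
      rw [shrinkLeft_apply, if_neg (by linarith)]

theorem endLeft_x1 : endLeft x1 = x1 := by
  refine conjEnd_eq_of_val (fun x => ?_) (fun y hy => Subtype.ext ?_)
  · rw [val_x1, val_x1]
    dsimp only
    rw [shrinkLeft_apply, shrinkLeft_apply]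
    unfold x1Fun
    split_ifs <;> linarith
  · rw [val_x1, x1Fun, if_pos]
    by_contra! h
    refine hy y y.2 ?_
    rw [shrinkLeft_apply, if_neg (by linarith)]

theorem three_quarters_lt_of_shrinkRight_ne {y : I}
    (hy : ∀ x ∈ Set.Icc (0 : ℝ) 1, shrinkRight x ≠ y) : 3 / 4 < (y : ℝ) := by
  by_contra! h
  have h0 := y.2.1
  rcases le_or_gt (y : ℝ) (1 / 2) with h2 | h2
  · refine hy y y.2 ?_
    rw [shrinkRight_apply, if_pos h2]
  · refine hy (2 * y - 1 / 2) ⟨by linarith, by linarith⟩ ?_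
    rw [shrinkRight_apply, if_neg (by linarith)]; ring

theorem endRight_x0 : endRight x0 = x0 * x1⁻¹ := by
  refine conjEnd_eq_of_val (fun x => ?_) (fun y hy => Subtype.ext ?_)
  · obtain ⟨h0, h1⟩ := x.2
    rw [val_x0_x1_inv, val_x0, shrinkRight_apply, shrinkRight_apply]
    unfold x0Fun
    split_ifs <;> linarith
  · have := three_quarters_lt_of_shrinkRight_ne hy
    rw [val_x0_x1_inv, if_neg (by linarith), if_neg (by linarith)]

theorem endRight_x1 : endRight x1 = x1 ^ 2 * x2⁻¹ * x1⁻¹ := by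
  refine conjEnd_eq_of_val (fun x => ?_) (fun y hy => Subtype.ext ?_)
  · obtain ⟨h0, h1⟩ := x.2
    rw [val_x1_sq_x2_inv_x1_inv, val_x1, shrinkRight_apply, shrinkRight_apply]
    unfold x1Fun
    split_ifs <;> linarith
  · have := three_quarters_lt_of_shrinkRight_ne hy
    rw [val_x1_sq_x2_inv_x1_inv, if_neg (by linarith), if_neg (by linarith),
      if_neg (by linarith), if_neg (by linarith)]

/-- Everything in the image fixes `1/8`, which lies outside `[1/4,1]`, whereas `x0` moves it. -/
theorem endLeft_not_surjective : ¬ Function.Surjective endLeft := by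
  intro h
  obtain ⟨f, hf⟩ := h x0
  have h8 : (1 / 8 : ℝ) ∈ Set.Icc (0 : ℝ) 1 := by constructor <;> norm_num
  have e : (ext x0)⁻¹ (1 / 8) = 1 / 8 := by
    refine inv_fix ?_
    rw [← hf, endLeft, ext_conjEnd]
    refine conj_fix (ext_apply_of_notMem_Icc f) fun x hx => ?_
    rw [shrinkLeft_apply]
    have := hx.1
    split_ifs <;> linarith
  have e' := ext_inv_apply x0 ⟨1 / 8, h8⟩
  dsimp only at e'
  rw [e, val_x0] at e'
  norm_num [x0Fun] at e'

end Contractions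

/-! ### Stabilizers with a frame -/

section Frames

open Equiv Filter Topology

/-- The piecewise linear homeomorphisms fixing all `v k` and all points outside `[v last, v 0]`,
for a decreasing sequence `v`. -/
def fixer {m : ℕ} (v : Fin (m + 2) → ℝ) : Subgroup (Perm ℝ) where
  carrier := {p | p ∈ PL ∧ (∀ k, p (v k) = v k) ∧
    ∀ x ∉ Set.Icc (v (Fin.last (m + 1))) (v 0), p x = x}
  mul_mem' := fun {p q} hp hq => ⟨PL.mul_mem hp.1 hq.1,
    fun k => by rw [Perm.mul_apply, hq.2.1, hp.2.1],
    fun x hx => by rw [Perm.mul_apply, hq.2.2 x hx, hp.2.2 x hx]⟩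
  one_mem' := ⟨PL.one_mem, fun _ => rfl, fun _ _ => rfl⟩
  inv_mem' := fun {p} hp => ⟨PL.inv_mem hp.1, fun k => inv_fix (hp.2.1 k),
    fun x hx => inv_fix (hp.2.2 x hx)⟩

theorem mem_fixer {m : ℕ} {v : Fin (m + 2) → ℝ} {p : Perm ℝ} :
    p ∈ fixer v ↔ p ∈ PL ∧ (∀ k, p (v k) = v k) ∧
      ∀ x ∉ Set.Icc (v (Fin.last (m + 1))) (v 0), p x = x := Iff.rfl

/-- A frame for a decreasing sequence `v` consists of neighbourhoods `[a j, b j]` of the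
inner points of `v`, parametrizations `g i` of the complementary intervals by `[0,1]`, and
homeomorphisms `s j` that are expanding on `[a j, b j]` and restrict to contractions of the two
adjacent complementary intervals. -/
structure Frame {m : ℕ} (v : Fin (m + 2) → ℝ) where
  anti : StrictAnti v
  not_dyadic : ∀ j : Fin m, ¬ IsDyadic (v j.succ.castSucc)
  a : Fin m → ℝ
  b : Fin m → ℝ
  a_lt : ∀ j, a j < v j.succ.castSucc
  lt_b : ∀ j, v j.succ.castSucc < b j
  g : Fin (m + 1) → Perm ℝ
  g_mem : ∀ i, g i ∈ PL
  g_zero_one : g 0 1 = v 0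
  g_last_zero : g (Fin.last m) 0 = v (Fin.last (m + 1))
  g_succ_one : ∀ j : Fin m, g j.succ 1 = a j
  g_castSucc_zero : ∀ j : Fin m, g j.castSucc 0 = b j
  s : Fin m → Perm ℝ
  s_mem : ∀ j, s j ∈ PL
  s_left : ∀ j, ∀ x ∈ Set.Icc (0 : ℝ) 1, s j (g j.castSucc x) = g j.castSucc (shrinkLeft x)
  s_right : ∀ j, ∀ x ∈ Set.Icc (0 : ℝ) 1, s j (g j.succ x) = g j.succ (shrinkRight x)
  s_of_le : ∀ j x, x ≤ g j.succ (1 / 2) → s j x = x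
  s_of_ge : ∀ j x, g j.castSucc (1 / 2) ≤ x → s j x = x
  e : Fin m → ℕ
  e_pos : ∀ j, 0 < e j
  s_affine : ∀ j, ∀ x ∈ Set.Icc (a j) (b j),
    s j x = v j.succ.castSucc + 2 ^ e j * (x - v j.succ.castSucc)
  e_dvd : ∀ j (n : ℤ), IsDyadic ((2 ^ n - 1) * v j.succ.castSucc) → (e j : ℤ) ∣ n

theorem half_mem_Icc : (1 / 2 : ℝ) ∈ Set.Icc (0 : ℝ) 1 := by constructor <;> norm_num

namespace Frame

variable {m : ℕ} {v : Fin (m + 2) → ℝ} (R : Frame v)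

theorem g_strictMono (i : Fin (m + 1)) : StrictMono (R.g i) := strictMono_of_mem_PL (R.g_mem i)

theorem le_g_zero (i : Fin (m + 1)) : v i.succ ≤ R.g i 0 := by
  induction i using Fin.lastCases with
  | last => exact R.g_last_zero.ge
  | cast j => rw [R.g_castSucc_zero]; exact (R.lt_b j).le

theorem g_one_le (i : Fin (m + 1)) : R.g i 1 ≤ v i.castSucc := by
  induction i using Fin.cases with
  | zero => exact R.g_zero_one.le
  | succ j => rw [R.g_succ_one]; exact (R.a_lt j).le

theorem g_le_g {i i' : Fin (m + 1)} (h : i < i') {x y : ℝ} (hx : x ≤ 1) (hy : 0 ≤ y) :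
    R.g i' x ≤ R.g i y :=
  calc R.g i' x ≤ R.g i' 1 := (R.g_strictMono i').monotone hx
    _ ≤ v i'.castSucc := R.g_one_le i'
    _ ≤ v i.succ := R.anti.antitone (by simpa [Fin.le_def] using h)
    _ ≤ R.g i 0 := R.le_g_zero i
    _ ≤ R.g i y := (R.g_strictMono i).monotone hy

theorem g_le_g' {i i' : Fin (m + 1)} (h : i ≤ i') {x : ℝ} (hx : x ∈ Set.Icc (0 : ℝ) 1) :
    R.g i' x ≤ R.g i x := by
  rcases h.eq_or_lt with rfl | h
  · exact le_rfl
  · exact R.g_le_g h hx.2 hx.1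

/-- A point of the line is outside `[v last, v 0]` or in one of the intervals of the frame. -/
theorem cover (x : ℝ) (hx : x ∈ Set.Icc (v (Fin.last (m + 1))) (v 0)) :
    (∃ j, x ∈ Set.Icc (R.a j) (R.b j)) ∨ ∃ i, x ∈ Set.Icc (R.g i 0) (R.g i 1) := by
  by_contra! h
  obtain ⟨h1, h2⟩ := h
  have h3 : ∀ i, x ≤ R.g i 1 → x < R.g i 0 := fun i hi =>
    not_le.1 fun hc => h2 i ⟨hc, hi⟩
  have key : ∀ i, x < R.g i 0 := by
    intro i
    induction i using Fin.induction with
    | zero => exact h3 _ (by rw [R.g_zero_one]; exact hx.2)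
    | succ j ih =>
      rw [R.g_castSucc_zero] at ih
      refine h3 _ ?_
      rw [R.g_succ_one]
      exact (not_le.1 fun hc => h1 j ⟨hc, ih.le⟩).le
  have := key (Fin.last m)
  rw [R.g_last_zero] at this
  exact absurd hx.1 (not_le.2 this)

theorem v_notMem (i : Fin (m + 1)) (k : Fin (m + 2)) :
    v k ∉ Set.Ioo (R.g i 0) (R.g i 1) := by
  rintro ⟨h1, h2⟩
  rcases le_or_gt k i.castSucc with h | h
  · exact absurd (h2.trans_le (R.g_one_le i)) (not_lt.2 (R.anti.antitone h))
  · exact absurd ((R.le_g_zero i).trans_lt h1)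
      (not_lt.2 (R.anti.antitone (Fin.castSucc_lt_iff_succ_le.1 h)))

theorem Icc_subset (i : Fin (m + 1)) :
    Set.Icc (R.g i 0) (R.g i 1) ⊆ Set.Icc (v (Fin.last (m + 1))) (v 0) := fun _ hx =>
  ⟨(R.anti.antitone (Fin.le_last _)).trans ((R.le_g_zero i).trans hx.1),
    hx.2.trans ((R.g_one_le i).trans (R.anti.antitone (Fin.zero_le _)))⟩

theorem notMem_Ioo_of_mem_Icc {i i' : Fin (m + 1)} (h : i ≠ i') {x : ℝ}
    (hx : x ∈ Set.Icc (R.g i 0) (R.g i 1)) : x ∉ Set.Ioo (R.g i' 0) (R.g i' 1) := by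
  rintro ⟨h1, h2⟩
  rcases h.lt_or_gt with h | h
  · exact absurd ((R.g_le_g h le_rfl le_rfl).trans hx.1) (not_le.2 h2)
  · exact absurd (hx.2.trans (R.g_le_g h le_rfl le_rfl)) (not_le.2 h1)

theorem mem_Icc_notMem_Ioo {j : Fin m} {x : ℝ} (hx : x ∈ Set.Icc (R.a j) (R.b j))
    (i : Fin (m + 1)) : x ∉ Set.Ioo (R.g i 0) (R.g i 1) := by
  rintro ⟨h1, h2⟩
  rcases le_or_gt i j.castSucc with h | h
  · have := R.g_le_g' h (x := 0) ⟨le_rfl, zero_le_one⟩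
    rw [R.g_castSucc_zero] at this
    linarith [hx.2]
  · have := R.g_le_g' (Fin.castSucc_lt_iff_succ_le.1 h) (x := 1) ⟨zero_le_one, le_rfl⟩
    rw [R.g_succ_one] at this
    linarith [hx.1]

end Frame

theorem ext_apply_of_notMem_Ioo (f : F) : ∀ x ∉ Set.Ioo (0 : ℝ) 1, ext f x = x := by
  intro x hx
  by_cases h : x ∈ Set.Icc (0 : ℝ) 1
  · rcases h.1.eq_or_lt with rfl | h0
    · exact (ext_apply f ⊥).trans (congrArg Subtype.val (f⁻¹).1.unop.map_bot)
    · rcases h.2.eq_or_lt with rfl | h1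
      · exact (ext_apply f ⊤).trans (congrArg Subtype.val (f⁻¹).1.unop.map_top)
      · exact absurd ⟨h0, h1⟩ hx
  · exact ext_apply_of_notMem f h

namespace Frame

variable {m : ℕ} {v : Fin (m + 2) → ℝ} (R : Frame v)

theorem conj_ext_fix (i : Fin (m + 1)) (f : F) {x : ℝ}
    (hx : x ∉ Set.Ioo (R.g i 0) (R.g i 1)) : (R.g i * ext f * (R.g i)⁻¹) x = x :=
  conj_fix (ext_apply_of_notMem_Ioo f) fun _ hy e =>
    hx (e ▸ ⟨R.g_strictMono i hy.1, R.g_strictMono i hy.2⟩)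

/-- The copy of `F` on the `i`-th complementary interval of a frame. -/
def factor (i : Fin (m + 1)) : F →* fixer v :=
  ((MulAut.conj (R.g i)).toMonoidHom.comp ext).codRestrict (fixer v) fun f =>
    ⟨PL.mul_mem (PL.mul_mem (R.g_mem i) (ext_mem_PL f)) (PL.inv_mem (R.g_mem i)),
      fun k => R.conj_ext_fix i f (R.v_notMem i k), fun _ hx => R.conj_ext_fix i f fun h =>
        hx (R.Icc_subset i ⟨h.1.le, h.2.le⟩)⟩

theorem coe_factor (i : Fin (m + 1)) (f : F) :
    (R.factor i f : Perm ℝ) = R.g i * ext f * (R.g i)⁻¹ := rfl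

theorem factor_fix (i : Fin (m + 1)) (f : F) {x : ℝ}
    (hx : x ∉ Set.Ioo (R.g i 0) (R.g i 1)) : (R.factor i f : Perm ℝ) x = x :=
  R.conj_ext_fix i f hx

theorem factor_commute : Pairwise fun i i' : Fin (m + 1) =>
    ∀ f f' : F, Commute (R.factor i f) (R.factor i' f') := by
  intro i i' h f f'
  have : Perm.Disjoint (R.factor i f : Perm ℝ) (R.factor i' f') := fun x => by
    by_cases hx : x ∈ Set.Ioo (R.g i 0) (R.g i 1)
    · exact .inr (R.factor_fix i' f' (R.notMem_Ioo_of_mem_Icc h ⟨hx.1.le, hx.2.le⟩))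
    · exact .inl (R.factor_fix i f hx)
  exact Subtype.ext this.commute

/-- The embedding of the base group given by a frame. -/
def base : BaseGroup m →* fixer v := MonoidHom.noncommPiCoprod R.factor R.factor_commute

theorem base_incl (i : Fin (m + 1)) (f : F) : R.base (incl i f) = R.factor i f :=
  MonoidHom.noncommPiCoprod_mulSingle ..

theorem base_fix {k : BaseGroup m} {x : ℝ} (h : ∀ i, (R.factor i (k i) : Perm ℝ) x = x) :
    (R.base k : Perm ℝ) x = x := by
  have : R.base k ∈ (MulAction.stabilizer (Perm ℝ) x).comap (fixer v).subtype := by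
    rw [base, MonoidHom.noncommPiCoprod_apply]
    exact Subgroup.noncommProd_mem _ _ fun i _ => h i
  exact this

theorem base_apply {k : BaseGroup m} {i : Fin (m + 1)} {x : ℝ}
    (hx : x ∈ Set.Icc (R.g i 0) (R.g i 1)) :
    (R.base k : Perm ℝ) x = (R.factor i (k i) : Perm ℝ) x := by
  -- Split off the `i`-th coordinate; the others act trivially on the `i`-th interval.
  have hk : k = incl i (k i) * Function.update k i 1 := by
    funext l
    rcases eq_or_ne l i with rfl | h
    · simp
    · simp [h]
  conv_lhs => rw [hk]
  rw [map_mul, base_incl, Subgroup.coe_mul, Perm.mul_apply, R.base_fix fun l => ?_]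
  rcases eq_or_ne l i with rfl | h
  · simp
  · exact R.factor_fix _ _ (R.notMem_Ioo_of_mem_Icc h.symm hx)

theorem base_injective : Function.Injective R.base := by
  refine (injective_iff_map_eq_one _).2 fun k hk => funext fun i => ?_
  have h1 : (R.factor i (k i) : Perm ℝ) = 1 := by
    ext x
    by_cases hx : x ∈ Set.Icc (R.g i 0) (R.g i 1)
    · rw [← R.base_apply hx, hk]; rfl
    · exact R.factor_fix _ _ fun h => hx ⟨h.1.le, h.2.le⟩
  rw [coe_factor, mul_inv_eq_one, mul_eq_left] at h1
  exact ext_injective (h1.trans (map_one _).symm)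

theorem base_fix_of_mem_Icc (k : BaseGroup m) {j : Fin m} {x : ℝ}
    (hx : x ∈ Set.Icc (R.a j) (R.b j)) : (R.base k : Perm ℝ) x = x :=
  R.base_fix fun i => R.factor_fix _ _ (R.mem_Icc_notMem_Ioo hx i)

/-- As `p` fixes both dyadic ends of the interval, it can be replaced by the identity outside and
carried to `[0,1]` by `g i`. -/
theorem exists_factor_eq {p : Perm ℝ} (hp : p ∈ PL) {i : Fin (m + 1)}
    (h0 : p (R.g i 0) = R.g i 0) (h1 : p (R.g i 1) = R.g i 1) :
    ∃ f : F, ∀ x ∈ Set.Icc (R.g i 0) (R.g i 1), (R.factor i f : Perm ℝ) x = p x := by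
  have hd0 := IsPL.map_dyadic (R.g_mem i) IsDyadic.zero
  have hd1 := IsPL.map_dyadic (R.g_mem i) IsDyadic.one
  have h01 : R.g i 0 < R.g i 1 := R.g_strictMono i zero_lt_one
  obtain ⟨q, hq, q₁, q₂⟩ := exists_glue hp PL.one_mem hd1 h1
  obtain ⟨r, hr, r₁, r₂⟩ := exists_glue PL.one_mem hq hd0 (by rw [q₁ _ h01.le, h0]; rfl)
  have hfix : ∀ x ∉ Set.Icc (R.g i 0) (R.g i 1), r x = x := by
    intro x hx
    rcases le_total x (R.g i 0) with h | h
    · exact r₁ x h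
    · rw [r₂ x h]
      refine q₂ x (not_le.1 fun h' => hx ⟨h, h'⟩).le
  obtain ⟨f, hf⟩ := exists_ext_eq (p := (R.g i)⁻¹ * r * ((R.g i)⁻¹)⁻¹)
    (PL.mul_mem (PL.mul_mem (PL.inv_mem (R.g_mem i)) hr) (PL.inv_mem (PL.inv_mem (R.g_mem i))))
    (fun x hx => conj_fix hfix fun y hy e => hx (by
      rw [Perm.inv_eq_iff_eq] at e
      subst e
      rwa [Set.mem_Icc, (R.g_strictMono i).le_iff_le, (R.g_strictMono i).le_iff_le] at hy))
  refine ⟨f, fun x hx => ?_⟩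
  have : (R.factor i f : Perm ℝ) = r := by
    rw [coe_factor, hf]; group
  rw [this, r₂ x hx.1, q₁ x hx.2]

/-- Such an element fixes the ends of all complementary intervals, hence is the product of its
restrictions to them. -/
theorem mem_range_base {p : fixer v}
    (h : ∀ j, ∀ x ∈ Set.Icc (R.a j) (R.b j), (p : Perm ℝ) x = x) : p ∈ R.base.range := by
  obtain ⟨p, hp⟩ := p
  dsimp only at h
  have hab : ∀ j, R.a j < R.b j := fun j => (R.a_lt j).trans (R.lt_b j)
  have h0 : ∀ i, p (R.g i 0) = R.g i 0 := by
    intro i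
    induction i using Fin.lastCases with
    | last => rw [R.g_last_zero, hp.2.1]
    | cast j => rw [R.g_castSucc_zero, h j _ ⟨(hab j).le, le_rfl⟩]
  have h1 : ∀ i, p (R.g i 1) = R.g i 1 := by
    intro i
    induction i using Fin.cases with
    | zero => rw [R.g_zero_one, hp.2.1]
    | succ j => rw [R.g_succ_one, h j _ ⟨le_rfl, (hab j).le⟩]
  choose k hk using fun i => R.exists_factor_eq hp.1 (h0 i) (h1 i)
  refine ⟨k, Subtype.ext (Perm.ext fun x => ?_)⟩
  by_cases hi : ∃ i, x ∈ Set.Icc (R.g i 0) (R.g i 1)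
  · obtain ⟨i, hi⟩ := hi
    rw [R.base_apply hi, hk i x hi]
  · rw [R.base_fix fun i => R.factor_fix _ _ fun hx => hi ⟨i, hx.1.le, hx.2.le⟩]
    by_cases hx : x ∈ Set.Icc (v (Fin.last (m + 1))) (v 0)
    · obtain ⟨j, hj⟩ := (R.cover x hx).resolve_right hi
      exact (h j x hj).symm
    · exact (hp.2.2 x hx).symm

/-! ### The stable letters of a frame -/

theorem s_fix {j j' : Fin m} (h : j ≠ j') {x : ℝ} (hx : x ∈ Set.Icc (R.a j') (R.b j')) :
    R.s j x = x := by
  rcases h.lt_or_gt with h | h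
  · refine R.s_of_le _ _ ?_
    calc x ≤ R.b j' := hx.2
      _ = R.g j'.castSucc 0 := (R.g_castSucc_zero j').symm
      _ ≤ R.g j'.castSucc (1 / 2) := (R.g_strictMono _).monotone (by norm_num)
      _ ≤ R.g j.succ (1 / 2) := R.g_le_g' (by simpa [Fin.le_def] using h) half_mem_Icc
  · refine R.s_of_ge _ _ ?_
    calc R.g j.castSucc (1 / 2) ≤ R.g j'.succ (1 / 2) :=
          R.g_le_g' (by simpa [Fin.le_def] using h) half_mem_Icc
      _ ≤ R.g j'.succ 1 := (R.g_strictMono _).monotone (by norm_num)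
      _ = R.a j' := R.g_succ_one j'
      _ ≤ x := hx.1

theorem mem_Icc_self (j : Fin m) : v j.succ.castSucc ∈ Set.Icc (R.a j) (R.b j) :=
  ⟨(R.a_lt j).le, (R.lt_b j).le⟩

theorem s_apply_self (j : Fin m) : R.s j (v j.succ.castSucc) = v j.succ.castSucc := by
  rw [R.s_affine j _ (R.mem_Icc_self j)]; simp

theorem s_mem_fixer (j : Fin m) : R.s j ∈ fixer v := by
  have h2 : R.g j.castSucc (1 / 2) ≤ v j.castSucc.castSucc :=
    ((R.g_strictMono _).monotone (by norm_num)).trans (R.g_one_le _)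
  have h3 : v j.succ.succ ≤ R.g j.succ (1 / 2) :=
    (R.le_g_zero _).trans ((R.g_strictMono _).monotone (by norm_num))
  refine ⟨R.s_mem j, fun k => ?_, fun x hx => ?_⟩
  · rcases lt_trichotomy k j.succ.castSucc with h | rfl | h
    · exact R.s_of_ge _ _ (h2.trans (R.anti.antitone (by
        simp only [Fin.lt_def, Fin.le_def, Fin.val_castSucc, Fin.val_succ] at h ⊢; omega)))
    · exact R.s_apply_self j
    · exact R.s_of_le _ _ (le_trans (R.anti.antitone (Fin.castSucc_lt_iff_succ_le.1 h)) h3)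
  · rcases le_or_gt x (v 0) with h | h
    · exact R.s_of_le _ _ ((lt_of_not_ge fun h' => hx ⟨h', h⟩).le.trans
        ((R.anti.antitone (Fin.le_last _)).trans h3))
    · exact R.s_of_ge _ _ (h2.trans ((R.anti.antitone (Fin.zero_le _)).trans h.le))

/-- The stable letters given by a frame. -/
def letter (j : Fin m) : fixer v := ⟨R.s j, R.s_mem_fixer j⟩⁻¹

theorem coe_letter_inv (j : Fin m) : (((R.letter j)⁻¹ : fixer v) : Perm ℝ) = R.s j := by
  rw [letter, inv_inv]

/-- The midpoint (in the coordinate `g i.succ`) of the interval just left of the `i`-th inner point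
separates the supports. -/
theorem s_commute {i j : Fin m} (h : i < j) : Commute (R.s i) (R.s j) := by
  refine Perm.Disjoint.commute fun x => ?_
  rcases le_total x (R.g i.succ (1 / 2)) with hx | hx
  · exact .inl (R.s_of_le _ _ hx)
  · exact .inr (R.s_of_ge _ _ ((R.g_le_g' (by simpa [Fin.le_def] using h) half_mem_Icc).trans hx))

theorem letter_commute (i j : Fin m) : Commute (R.letter i) (R.letter j) := by
  have key : ∀ {i j : Fin m}, i < j → Commute (R.letter i) (R.letter j) := fun h =>
    Commute.inv_inv (Subtype.ext (R.s_commute h))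
  rcases lt_trichotomy i j with h | rfl | h
  · exact key h
  · exact Commute.refl _
  · exact (key h).symm

end Frame

/-- The action of the `j`-th stable letter on the `i`-th direct factor. -/
def letterComponent {m : ℕ} (j : Fin m) (i : Fin (m + 1)) : F →* F :=
  if i = j.castSucc then endLeft else if i = j.succ then endRight else MonoidHom.id F

/-- The action of the `j`-th stable letter on the base group. -/
def letterEnd {m : ℕ} (j : Fin m) : BaseGroup m →* BaseGroup m :=
  MonoidHom.piMap (letterComponent j)

theorem letterEnd_incl {m : ℕ} (j : Fin m) (i : Fin (m + 1)) (f : F) :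
    letterEnd j (incl i f) = incl i (letterComponent j i f) := by
  funext l
  rcases eq_or_ne l i with rfl | h
  · simp [letterEnd]
  · simp [letterEnd, h]

namespace Frame

variable {m : ℕ} {v : Fin (m + 2) → ℝ} (R : Frame v)

/-- On the interval to the right of the inner point `s j` is `shrinkLeft` in coordinates, on the one
to the left it is `shrinkRight`, and on all others it is the identity. -/
theorem s_conj_factor (j : Fin m) (i : Fin (m + 1)) (f : F) :
    R.s j * (R.g i * ext f * (R.g i)⁻¹) * (R.s j)⁻¹ =
      R.g i * ext (letterComponent j i f) * (R.g i)⁻¹ := by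
  have reassoc : R.s j * (R.g i * ext f * (R.g i)⁻¹) * (R.s j)⁻¹ =
      (R.s j * R.g i) * ext f * (R.s j * R.g i)⁻¹ := by group
  rw [reassoc, letterComponent]
  split_ifs with h1 h2
  · subst h1
    rw [conj_eq_conj_of_eqOn (ext_apply_of_notMem_Icc f)
      (s' := R.g j.castSucc * shrinkLeft) fun x hx => R.s_left j x hx, endLeft, ext_conjEnd]
    group
  · subst h2
    rw [conj_eq_conj_of_eqOn (ext_apply_of_notMem_Icc f)
      (s' := R.g j.succ * shrinkRight) fun x hx => R.s_right j x hx, endRight, ext_conjEnd]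
    group
  · refine conj_eq_conj_of_eqOn (ext_apply_of_notMem_Icc f) fun x hx => ?_
    rw [Perm.mul_apply]
    rcases lt_or_ge i j.castSucc with h | h
    · exact R.s_of_ge _ _ (R.g_le_g h (by norm_num) hx.1)
    · have : j.succ < i := by
        refine lt_of_le_of_ne ?_ (Ne.symm h2)
        exact Fin.castSucc_lt_iff_succ_le.1 (lt_of_le_of_ne h (Ne.symm h1))
      exact R.s_of_le _ _ (R.g_le_g this hx.2 (by norm_num))

theorem ascRel : AscRel letterEnd R.base R.letter where
  comm := R.letter_commute
  conj := by
    intro j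
    have : (MulAut.conj (R.letter j)⁻¹).toMonoidHom.comp R.base = R.base.comp (letterEnd j) := by
      refine MonoidHom.pi_ext fun i f => ?_
      change MulAut.conj (R.letter j)⁻¹ (R.base (incl i f)) = R.base (letterEnd j (incl i f))
      rw [letterEnd_incl, base_incl, base_incl]
      refine Subtype.ext ?_
      rw [MulAut.conj_apply, Subgroup.coe_mul, Subgroup.coe_mul, R.coe_letter_inv,
        Subgroup.coe_inv, R.coe_letter_inv, coe_factor, coe_factor]
      exact R.s_conj_factor j i f
    intro k
    have := DFunLike.congr_fun this k
    simpa using this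

end Frame

end Frames

/-! ### Slopes at the inner points, and generation by the base and the letters -/

section Generation

open Equiv Filter Topology

theorem hasDerivAt_of_eventually_eq {f : ℝ → ℝ} {u r : ℝ}
    (h : ∀ᶠ y in 𝓝 u, f y = u + r * (y - u)) : HasDerivAt f r u := by
  have : HasDerivAt (fun y => u + r * (y - u)) r u := by
    simpa using (((hasDerivAt_id u).sub_const u).const_mul r).const_add u
  exact this.congr_of_eventuallyEq h

/-- The local affine form `2 ^ n * y + c` has dyadic `c`, and fixing `u` means `c = -(2 ^ n - 1) *
u`. This is what restricts the possible slopes. -/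
theorem exists_eventually_eq_of_fix {p : Perm ℝ} (hp : p ∈ PL) {u : ℝ} (hu : ¬ IsDyadic u)
    (hpu : p u = u) : ∃ n : ℤ, IsDyadic ((2 ^ n - 1) * u) ∧
      ∀ᶠ y in 𝓝 u, p y = u + 2 ^ n * (y - u) := by
  obtain ⟨n, c, hc, h⟩ := IsPL.eventually_affine hp hu
  have e : u = 2 ^ n * u + c := hpu.symm.trans h.self_of_nhds
  refine ⟨n, ?_, ?_⟩
  · have : (2 ^ n - 1) * u = -c := by linear_combination -e
    rw [this]; exact hc.neg
  · filter_upwards [h] with y hy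
    rw [hy]; linear_combination -e

namespace Frame

variable {m : ℕ} {v : Fin (m + 2) → ℝ} (R : Frame v)

theorem exists_slope (R : Frame v) (j : Fin m) (p : fixer v) :
    ∃ n : ℤ, IsDyadic ((2 ^ n - 1) * v j.succ.castSucc) ∧
      ∀ᶠ y in 𝓝 (v j.succ.castSucc),
        (p : Perm ℝ) y = v j.succ.castSucc + 2 ^ n * (y - v j.succ.castSucc) :=
  exists_eventually_eq_of_fix p.2.1 (R.not_dyadic j) (p.2.2.1 _)

/-- The slope at the `j`-th inner point, as a character. -/
def slope (R : Frame v) (j : Fin m) : fixer v →* ℝ where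
  toFun p := deriv (p : Perm ℝ) (v j.succ.castSucc)
  map_one' := (hasDerivAt_id _).deriv
  map_mul' p q := by
    obtain ⟨n, -, hn⟩ := R.exists_slope j p
    obtain ⟨k, -, hk⟩ := R.exists_slope j q
    have hn := hasDerivAt_of_eventually_eq hn
    have hk := hasDerivAt_of_eventually_eq hk
    rw [hn.deriv, hk.deriv]
    refine HasDerivAt.deriv (f := (p : Perm ℝ) ∘ (q : Perm ℝ)) ?_
    refine HasDerivAt.comp _ ?_ hk
    rwa [q.2.2.1]

theorem slope_eq {j : Fin m} {p : fixer v} {r : ℝ}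
    (h : ∀ᶠ y in 𝓝 (v j.succ.castSucc),
      (p : Perm ℝ) y = v j.succ.castSucc + r * (y - v j.succ.castSucc)) : R.slope j p = r :=
  (hasDerivAt_of_eventually_eq h).deriv

theorem eventually_mem_Icc (j : Fin m) :
    ∀ᶠ y in 𝓝 (v j.succ.castSucc), y ∈ Set.Icc (R.a j) (R.b j) :=
  Icc_mem_nhds (R.a_lt j) (R.lt_b j)

theorem slope_eq_one {j : Fin m} {p : fixer v}
    (h : ∀ x ∈ Set.Icc (R.a j) (R.b j), (p : Perm ℝ) x = x) : R.slope j p = 1 := by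
  refine R.slope_eq ?_
  filter_upwards [R.eventually_mem_Icc j] with y hy
  rw [h y hy]; ring

theorem letter_fix {j j' : Fin m} (h : j ≠ j') {x : ℝ} (hx : x ∈ Set.Icc (R.a j') (R.b j')) :
    (R.letter j : Perm ℝ) x = x :=
  inv_fix (R.s_fix h hx)

theorem slope_letter (j : Fin m) : R.slope j (R.letter j) = 2 ^ (-(R.e j : ℤ)) := by
  have h : R.slope j (R.letter j)⁻¹ = 2 ^ R.e j := by
    refine R.slope_eq ?_
    filter_upwards [R.eventually_mem_Icc j] with y hy
    rw [R.coe_letter_inv, R.s_affine j y hy]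
  have h2 : R.slope j (R.letter j)⁻¹ * R.slope j (R.letter j) = 1 := by
    rw [← map_mul, inv_mul_cancel, map_one]
  rw [h] at h2
  rw [zpow_neg, zpow_natCast]
  exact eq_inv_of_mul_eq_one_right h2

theorem ascChar : AscChar R.base R.letter R.slope where
  base := fun _ _ => R.slope_eq_one fun _ hx => R.base_fix_of_mem_Icc _ hx
  off := fun _ _ h => R.slope_eq_one fun _ hx => R.letter_fix h hx
  pos := fun j => by rw [slope_letter]; positivity
  ne_one := fun j => by
    rw [slope_letter, zpow_neg, zpow_natCast]
    have : (1 : ℝ) < 2 ^ R.e j := one_lt_pow₀ one_lt_two (R.e_pos j).ne'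
    exact (inv_lt_one_of_one_lt₀ this).ne

theorem letter_pow_apply (j : Fin m) (N : ℕ) {x : ℝ} (hx : x ∈ Set.Icc (R.a j) (R.b j)) :
    ((R.letter j ^ N : fixer v) : Perm ℝ) x =
      v j.succ.castSucc + (1 / 2 ^ R.e j) ^ N * (x - v j.succ.castSucc) := by
  have hu := R.a_lt j
  have hu' := R.lt_b j
  have hr0 : (0 : ℝ) < 1 / 2 ^ R.e j := by positivity
  have hr1 : (1 : ℝ) / 2 ^ R.e j ≤ 1 := by
    rw [div_le_one (by positivity)]; exact one_le_pow₀ one_le_two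
  induction N with
  | zero => simp
  | succ N ih =>
    set u := v j.succ.castSucc
    set r : ℝ := 1 / 2 ^ R.e j with hr
    have hp0 : 0 ≤ r ^ (N + 1) := by positivity
    have hp1 : r ^ (N + 1) ≤ 1 := pow_le_one₀ hr0.le hr1
    -- Contracting towards `u` stays in the neighbourhood, where the affine formula for `s j` is
    -- valid.
    have hmem : u + r ^ (N + 1) * (x - u) ∈ Set.Icc (R.a j) (R.b j) := by
      obtain ⟨h1, h2⟩ := hx
      constructor
      · nlinarith [mul_le_mul_of_nonneg_left h1 hp0]
      · nlinarith [mul_le_mul_of_nonneg_left h2 hp0]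
    rw [pow_succ', Subgroup.coe_mul, Perm.mul_apply, ih]
    change (R.s j)⁻¹ _ = _
    rw [Perm.inv_eq_iff_eq, R.s_affine j _ hmem, pow_succ', hr]
    field_simp; ring

/-- A high power of the letter contracts all of `[a j, b j]` into the neighbourhood on which `p` is
already the identity. -/
theorem exists_letter_pow_conj_fix (j : Fin m) {p : fixer v}
    (hp : ∀ᶠ y in 𝓝 (v j.succ.castSucc), (p : Perm ℝ) y = y) :
    ∃ N : ℕ, ∀ x ∈ Set.Icc (R.a j) (R.b j),
      (((R.letter j ^ N)⁻¹ * p * R.letter j ^ N : fixer v) : Perm ℝ) x = x := by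
  obtain ⟨ε, hε, H⟩ := Metric.eventually_nhds_iff.1 hp
  set u := v j.succ.castSucc with hu
  have hlt : (1 : ℝ) / 2 ^ R.e j < 1 := by
    rw [div_lt_one (by positivity)]; exact one_lt_pow₀ one_lt_two (R.e_pos j).ne'
  have hab : 0 < R.b j - R.a j := sub_pos.2 ((R.a_lt j).trans (R.lt_b j))
  obtain ⟨N, hN⟩ := exists_pow_lt_of_lt_one (div_pos hε hab) hlt
  refine ⟨N, fun x hx => ?_⟩
  rw [Subgroup.coe_mul, Subgroup.coe_mul, Subgroup.coe_inv, Perm.mul_apply, Perm.mul_apply,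
    Perm.inv_eq_iff_eq]
  refine H ?_
  rw [R.letter_pow_apply j N hx, Real.dist_eq, add_sub_cancel_left, abs_mul,
    abs_of_pos (by positivity)]
  have hxu : |x - u| ≤ R.b j - R.a j := by
    rw [abs_le]
    have h1 := R.a_lt j
    have h2 := R.lt_b j
    constructor <;> linarith [hx.1, hx.2]
  calc (1 / 2 ^ R.e j) ^ N * |x - u| ≤ (1 / 2 ^ R.e j) ^ N * (R.b j - R.a j) := by gcongr
    _ < ε := by rwa [lt_div_iff₀ hab] at hN

theorem coe_letter_zpow_fix {j j' : Fin m} (h : j ≠ j') {x : ℝ}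
    (hx : x ∈ Set.Icc (R.a j') (R.b j')) (n : ℤ) :
    ((R.letter j ^ n : fixer v) : Perm ℝ) x = x := by
  have : R.letter j ∈ (MulAction.stabilizer (Perm ℝ) x).comap (fixer v).subtype :=
    R.letter_fix h hx
  exact Subgroup.zpow_mem _ this n

theorem base_sup_letters : R.base.range ⊔ Subgroup.closure (Set.range R.letter) = ⊤ := by
  classical
  set T := R.base.range ⊔ Subgroup.closure (Set.range R.letter) with hT
  have hlet : ∀ j, R.letter j ∈ T := fun j =>
    Subgroup.mem_sup_right (Subgroup.subset_closure ⟨j, rfl⟩)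
  -- `S` collects the indices of the neighbourhoods on which `p` may still be non-trivial; one is
  -- removed at a time.
  suffices H : ∀ (S : Finset (Fin m)) (p : fixer v),
      (∀ j ∉ S, ∀ x ∈ Set.Icc (R.a j) (R.b j), (p : Perm ℝ) x = x) → p ∈ T from
    (Subgroup.eq_top_iff' T).2 fun p => H Finset.univ p (by simp)
  intro S
  induction S using Finset.induction_on with
  | empty =>
    intro p hp
    exact Subgroup.mem_sup_left (R.mem_range_base fun j => hp j (Finset.notMem_empty j))
  | insert j S hj ih =>
    intro p hp
    obtain ⟨n, hn, hpn⟩ := R.exists_slope j p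
    obtain ⟨k, rfl⟩ := R.e_dvd j n hn
    -- The slope of `p` is `2 ^ (e j * k)` and that of the letter is `2 ^ (-e j)`, so `q` has slope
    -- `1` at the inner point and is the identity near it.
    set q := p * R.letter j ^ k with hq
    have hqfix : ∀ i ∉ insert j S, ∀ x ∈ Set.Icc (R.a i) (R.b i), (q : Perm ℝ) x = x := by
      intro i hi x hx
      have hij : j ≠ i := fun h => hi (by simp [h])
      rw [hq, Subgroup.coe_mul, Perm.mul_apply, R.coe_letter_zpow_fix hij hx, hp i hi x hx]
    have hqj : ∀ᶠ y in 𝓝 (v j.succ.castSucc), (q : Perm ℝ) y = y := by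
      obtain ⟨l, -, hl⟩ := R.exists_slope j q
      have e1 : R.slope j q = 1 := by
        have hz : R.slope j (R.letter j ^ k) = (R.slope j (R.letter j)) ^ k := by
          have hne : R.slope j (R.letter j) ≠ 0 := (R.ascChar.pos j).ne'
          rcases k.eq_nat_or_neg with ⟨k', rfl | rfl⟩
          · rw [zpow_natCast, zpow_natCast, map_pow]
          · rw [zpow_neg, zpow_neg, zpow_natCast, zpow_natCast, ← map_pow]
            refine eq_inv_of_mul_eq_one_left ?_
            rw [← map_mul, inv_mul_cancel, map_one]
        rw [hq, map_mul, R.slope_eq hpn, hz, slope_letter, ← zpow_mul,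
          ← zpow_add₀ two_ne_zero]
        simp
      have e2 : (2 : ℝ) ^ l = 1 := (R.slope_eq hl).symm.trans e1
      filter_upwards [hl] with y hy
      rw [hy, e2]; ring
    obtain ⟨N, hN⟩ := R.exists_letter_pow_conj_fix j hqj
    have hr := ih ((R.letter j ^ N)⁻¹ * q * R.letter j ^ N) (by
      intro i hi x hx
      by_cases hij : i = j
      · subst hij; exact hN x hx
      · have hfix := R.coe_letter_zpow_fix (Ne.symm hij) hx N
        rw [zpow_natCast] at hfix
        rw [Subgroup.coe_mul, Subgroup.coe_mul, Subgroup.coe_inv, Perm.mul_apply,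
          Perm.mul_apply, hfix, hqfix i (by simp [hij, hi]) x hx, inv_fix hfix])
    have e : p = R.letter j ^ N * ((R.letter j ^ N)⁻¹ * q * R.letter j ^ N) *
        (R.letter j ^ N)⁻¹ * (R.letter j ^ k)⁻¹ := by rw [hq]; group
    rw [e]
    exact T.mul_mem (T.mul_mem (T.mul_mem (T.pow_mem (hlet j) N) hr)
      (T.inv_mem (T.pow_mem (hlet j) N))) (T.inv_mem (T.zpow_mem (hlet j) k))

end Frame

end Generation

/-! ### Existence of frames -/

section Existence

open Equiv Filter Topology

theorem exists_dyadic_between {x y : ℝ} (h : x < y) : ∃ z, IsDyadic z ∧ x < z ∧ z < y := by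
  obtain ⟨n, hn⟩ := exists_pow_lt_of_lt_one (sub_pos.2 h) (by norm_num : (1 / 2 : ℝ) < 1)
  have hp : (0 : ℝ) < 2 ^ n := by positivity
  refine ⟨_, ⟨⌊x * 2 ^ n⌋ + 1, n, rfl⟩, ?_, ?_⟩
  · rw [lt_div_iff₀ hp]; push_cast; exact Int.lt_floor_add_one _
  · rw [div_lt_iff₀ hp]
    push_cast
    have h1 := Int.floor_le (x * 2 ^ n)
    have h2 : 1 < (y - x) * 2 ^ n := by
      rw [one_div, inv_pow, inv_lt_iff_one_lt_mul₀ hp] at hn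
      linarith
    linarith

/-- The admissible exponents form a subgroup of `ℤ`, hence a cyclic one. It is non-zero by Euler's
theorem: `2 ^ φ(d) - 1` is divisible by the odd part `d` of the denominator. -/
theorem exists_order {u : ℝ} (hu : u ∈ Set.range ((↑) : ℚ → ℝ)) :
    ∃ e : ℕ, 0 < e ∧ IsDyadic ((2 ^ e - 1) * u) ∧
      ∀ n : ℤ, IsDyadic ((2 ^ n - 1) * u) → (e : ℤ) ∣ n := by
  let H : AddSubgroup ℤ :=
    { carrier := {n | IsDyadic ((2 ^ n - 1) * u)}
      zero_mem' := by simpa using IsDyadic.zero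
      add_mem' := fun {n k} hn hk => by
        have : ((2 : ℝ) ^ (n + k) - 1) * u = 2 ^ n * ((2 ^ k - 1) * u) + (2 ^ n - 1) * u := by
          rw [zpow_add₀ two_ne_zero]; ring
        change IsDyadic _
        rw [this]
        exact (IsDyadic.zpow_mul hk n).add hn
      neg_mem' := fun {n} hn => by
        have : ((2 : ℝ) ^ (-n) - 1) * u = -(2 ^ (-n) * ((2 ^ n - 1) * u)) := by
          have : (2 : ℝ) ^ (-n) * 2 ^ n = 1 := by
            rw [← zpow_add₀ two_ne_zero]; simp
          linear_combination u * this
        change IsDyadic _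
        rw [this]
        exact (IsDyadic.zpow_mul hn (-n)).neg }
  obtain ⟨c, hc⟩ := Int.subgroup_cyclic H
  have hmem : ∀ n : ℤ, IsDyadic ((2 ^ n - 1) * u) ↔ c ∣ n := fun n => by
    rw [← Int.mem_zmultiples_iff, AddSubgroup.zmultiples_eq_closure, ← hc]; rfl
  obtain ⟨N, hN0, hN⟩ : ∃ N : ℕ, 0 < N ∧ IsDyadic ((2 ^ (N : ℤ) - 1) * u) := by
    obtain ⟨q, rfl⟩ := hu
    obtain ⟨s, d, hd, hqd⟩ := Nat.exists_eq_two_pow_mul_odd q.den_nz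
    have hd2 : Nat.Coprime 2 d := Nat.coprime_two_left.2 hd
    refine ⟨d.totient, Nat.totient_pos.2 hd.pos, ?_⟩
    obtain ⟨w, hw⟩ := (Nat.modEq_iff_dvd' Nat.one_le_two_pow).1
      (Nat.ModEq.pow_totient hd2).symm
    refine ⟨w * q.num, s, ?_⟩
    have h1 : ((2 : ℝ) ^ d.totient - 1) = d * w := by
      have := congrArg (Nat.cast : ℕ → ℝ) hw
      rw [Nat.cast_sub Nat.one_le_two_pow] at this
      push_cast at this
      exact this
    have hd0 : (d : ℝ) ≠ 0 := by exact_mod_cast hd.pos.ne'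
    rw [zpow_natCast, h1, Rat.cast_def, hqd]
    push_cast
    field_simp
  have hcN := (hmem N).1 hN
  refine ⟨c.natAbs, Int.natAbs_pos.2 ?_, ?_, fun n hn => Int.natAbs_dvd.2 ((hmem n).1 hn)⟩
  · rintro rfl
    rw [zero_dvd_iff] at hcN
    omega
  · have := (hmem c.natAbs).2 (Int.dvd_natAbs.2 dvd_rfl)
    rwa [zpow_natCast] at this

/-- A dyadic neighbourhood of a rational point, and an affine expansion of it. -/
theorem exists_expansion {u δ : ℝ} (hq : u ∈ Set.range ((↑) : ℚ → ℝ))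
    (hδ : 0 < δ) : ∃ (e : ℕ) (a b : ℝ) (p : Perm ℝ), 0 < e ∧
      (∀ n : ℤ, IsDyadic ((2 ^ n - 1) * u) → (e : ℤ) ∣ n) ∧ IsDyadic a ∧ IsDyadic b ∧
      a < u ∧ u < b ∧ p ∈ PL ∧ (∀ x, p x = u + 2 ^ e * (x - u)) ∧
      u - δ < p a ∧ p a < a ∧ b < p b ∧ p b < u + δ := by
  obtain ⟨e, he, hed, hdvd⟩ := exists_order hq
  obtain ⟨p, hp, hpx⟩ := exists_affine e hed.neg
  have hpx' : ∀ x, p x = u + 2 ^ e * (x - u) := fun x => by rw [hpx, zpow_natCast]; ring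
  have h2 : (1 : ℝ) < 2 ^ e := one_lt_pow₀ one_lt_two he.ne'
  have h0 : (0 : ℝ) < 2 ^ e := by positivity
  -- Points this close to `u` remain within `δ` of it after the expansion.
  have hδe : 0 < δ / 2 ^ e := by positivity
  obtain ⟨a, ha, ha1, ha2⟩ := exists_dyadic_between (show u - δ / 2 ^ e < u by linarith)
  obtain ⟨b, hb, hb1, hb2⟩ := exists_dyadic_between (show u < u + δ / 2 ^ e by linarith)
  have ha3 : u - a < δ / 2 ^ e := by linarith
  have hb3 : b - u < δ / 2 ^ e := by linarith
  rw [lt_div_iff₀ h0] at ha3 hb3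
  refine ⟨e, a, b, p, he, hdvd, ha, hb, ha2, hb1, hp, hpx', ?_, ?_, ?_, ?_⟩
  · rw [hpx']; linarith
  · rw [hpx']; nlinarith
  · rw [hpx']; nlinarith
  · rw [hpx']; linarith

/-- The homeomorphism that is the given affine expansion `p` on `[a,b]` and a contraction of each
of the two adjacent intervals. -/
theorem exists_stable_letter {g g' p : Perm ℝ} (hg : g ∈ PL) (hg' : g' ∈ PL) (hp : p ∈ PL)
    (hab : g' 1 ≤ g 0) (h0 : p (g 0) = g (1 / 4)) (h1 : p (g' 1) = g' (3 / 4)) :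
    ∃ s ∈ PL, (∀ x ∈ Set.Icc (0 : ℝ) 1, s (g x) = g (shrinkLeft x)) ∧
      (∀ x ∈ Set.Icc (0 : ℝ) 1, s (g' x) = g' (shrinkRight x)) ∧
      (∀ x, x ≤ g' (1 / 2) → s x = x) ∧ (∀ x, g (1 / 2) ≤ x → s x = x) ∧
      ∀ x ∈ Set.Icc (g' 1) (g 0), s x = p x := by
  have mg := strictMono_of_mem_PL hg
  have mg' := strictMono_of_mem_PL hg'
  -- The pieces fit because `shrinkLeft 0 = 1/4` and `shrinkRight 1 = 3/4`, which is what `h0` and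
  -- `h1` ask of `p` in coordinates.
  obtain ⟨q, hq, q₁, q₂⟩ := exists_glue hp
    (PL.mul_mem (PL.mul_mem hg shrinkLeft_mem_PL) (PL.inv_mem hg))
    (IsPL.map_dyadic hg IsDyadic.zero) (by
      rw [h0, conj_apply_apply, shrinkLeft_apply]; norm_num)
  obtain ⟨s, hs, s₁, s₂⟩ := exists_glue
    (PL.mul_mem (PL.mul_mem hg' shrinkRight_mem_PL) (PL.inv_mem hg')) hq
    (IsPL.map_dyadic hg' IsDyadic.one) (by
      rw [q₁ _ hab, h1, conj_apply_apply, shrinkRight_apply]; norm_num)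
  refine ⟨s, hs, fun x hx => ?_, fun x hx => ?_, fun x hx => ?_, fun x hx => ?_, fun x hx => ?_⟩
  · have := mg.monotone hx.1
    rw [s₂ _ (hab.trans this), q₂ _ this, conj_apply_apply]
  · rw [s₁ _ (mg'.monotone hx.2), conj_apply_apply]
  · obtain ⟨y, rfl⟩ := g'.surjective x
    rw [mg'.le_iff_le] at hx
    rw [s₁ _ (mg'.monotone (by linarith)), conj_apply_apply, shrinkRight_apply, if_pos hx]
  · obtain ⟨y, rfl⟩ := g.surjective x
    rw [mg.le_iff_le] at hx
    have h0y : g 0 ≤ g y := mg.monotone (by linarith)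
    rw [s₂ _ (hab.trans h0y), q₂ _ h0y, conj_apply_apply, shrinkLeft_apply]
    split_ifs with h
    · congr 1; linarith
    · rfl
  · rw [s₂ _ hx.1, q₁ _ hx.2]

/-- The expansions `p j` around the inner points come first. The coordinate of the interval between
two neighbouring inner points then sends `0, 1/4, 3/4, 1` to `b`, `p b`, `p a`, `a`, with `b` and
`a` taken from the inner points on its left and right. In these coordinates the expansions move the
ends exactly as the two contractions do. -/
theorem nonempty_frame {m : ℕ} {v : Fin (m + 2) → ℝ} (anti : StrictAnti v)
    (not_dyadic : ∀ j : Fin m, ¬ IsDyadic (v j.succ.castSucc))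
    (rational : ∀ j : Fin m, v j.succ.castSucc ∈ Set.range ((↑) : ℚ → ℝ))
    (dyadic_zero : IsDyadic (v 0)) (dyadic_last : IsDyadic (v (Fin.last (m + 1)))) :
    Nonempty (Frame v) := by
  -- With `δ` below half of every gap, the expanded neighbourhoods of different points stay
  -- disjoint.
  obtain ⟨δ, hδ, hgap⟩ : ∃ δ : ℝ, 0 < δ ∧
      ∀ i : Fin (m + 1), v i.succ + δ < v i.castSucc - δ := by
    have : ∀ᶠ δ in 𝓝[>] (0 : ℝ), ∀ i : Fin (m + 1), v i.succ + δ < v i.castSucc - δ := by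
      refine eventually_all.2 fun i => ?_
      have h : v i.succ < v i.castSucc := anti (Fin.castSucc_lt_succ)
      have h2 : 0 < (v i.castSucc - v i.succ) / 2 := by linarith
      filter_upwards [Ioo_mem_nhdsGT h2] with δ hδ
      linarith [hδ.2]
    obtain ⟨δ, h1, h2⟩ := (this.and self_mem_nhdsWithin).exists
    exact ⟨δ, h2, h1⟩
  choose e a b p he hdvd ha hb hau hub hp hpx hpa hpa' hpb hpb' using
    fun j => exists_expansion (rational j) hδ
  -- At the two outer ends nothing is expanded, and any dyadic point close to the end can serve as
  -- the second marked point.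
  obtain ⟨l₁, hl₁, hl₁', hl₁''⟩ := exists_dyadic_between
    (show v (Fin.last (m + 1)) < v (Fin.last (m + 1)) + δ by linarith)
  obtain ⟨r₁, hr₁, hr₁', hr₁''⟩ := exists_dyadic_between (show v 0 - δ < v 0 by linarith)
  have left : ∀ i : Fin (m + 1), ∃ l l' : ℝ, IsDyadic l ∧ IsDyadic l' ∧ l < l' ∧
      l' < v i.succ + δ ∧ (i = Fin.last m → l = v (Fin.last (m + 1))) ∧
      ∀ j : Fin m, i = j.castSucc → l = b j ∧ l' = p j (b j) := by
    intro i
    induction i using Fin.lastCases with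
    | last =>
      exact ⟨_, l₁, dyadic_last, hl₁, hl₁', hl₁'', fun _ => rfl,
        fun j hj => absurd hj (Fin.castSucc_lt_last j).ne'⟩
    | cast j =>
      refine ⟨b j, p j (b j), hb j, IsPL.map_dyadic (hp j) (hb j), hpb j, hpb' j,
        fun h => absurd h (Fin.castSucc_lt_last j).ne, fun j' hj => ?_⟩
      rw [Fin.castSucc_injective _ hj]; exact ⟨rfl, rfl⟩
  have right : ∀ i : Fin (m + 1), ∃ r' r : ℝ, IsDyadic r' ∧ IsDyadic r ∧ r' < r ∧
      v i.castSucc - δ < r' ∧ (i = 0 → r = v 0) ∧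
      ∀ j : Fin m, i = j.succ → r = a j ∧ r' = p j (a j) := by
    intro i
    induction i using Fin.cases with
    | zero =>
      exact ⟨r₁, _, hr₁, dyadic_zero, hr₁'', hr₁', fun _ => rfl,
        fun j hj => absurd hj (Fin.succ_ne_zero j).symm⟩
    | succ j =>
      refine ⟨p j (a j), a j, IsPL.map_dyadic (hp j) (ha j), ha j, hpa' j, hpa j,
        fun h => absurd h (Fin.succ_ne_zero j), fun j' hj => ?_⟩
      rw [Fin.succ_injective _ hj]; exact ⟨rfl, rfl⟩
  choose l l' hl hl' hll' hlδ hllast hlb using left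
  choose r' r hr' hr hrr' hrδ hrzero hra using right
  choose g hg hg0 hg1 hg3 hg4 using fun i => exists_mem_PL_four IsDyadic.zero
    IsDyadic.one_quarter IsDyadic.three_quarters IsDyadic.one (hl i) (hl' i) (hr' i) (hr i)
    (by norm_num) (by norm_num) (by norm_num) (hll' i)
    ((hlδ i).trans ((hgap i).trans (hrδ i))) (hrr' i)
  have gsucc : ∀ j : Fin m, g j.succ 1 = a j := fun j => by rw [hg4, (hra _ j rfl).1]
  have gcast : ∀ j : Fin m, g j.castSucc 0 = b j := fun j => by rw [hg0, (hlb _ j rfl).1]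
  choose s hs s₁ s₂ s₃ s₄ s₅ using fun j : Fin m => exists_stable_letter (hg j.castSucc)
    (hg j.succ) (hp j) (by rw [gsucc, gcast]; exact ((hau j).trans (hub j)).le)
    (by rw [gcast, hg1, (hlb _ j rfl).2]) (by rw [gsucc, hg3, (hra _ j rfl).2])
  exact ⟨{
    anti, not_dyadic, a, b, a_lt := hau, lt_b := hub, g, g_mem := hg
    g_zero_one := by rw [hg4, hrzero 0 rfl]
    g_last_zero := by rw [hg0, hllast _ rfl]
    g_succ_one := gsucc, g_castSucc_zero := gcast, s, s_mem := hs
    s_left := s₁, s_right := s₂, s_of_le := s₃, s_of_ge := s₄, e, e_pos := he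
    s_affine := fun j x hx => by rw [s₅ j x (by rwa [gsucc, gcast]), hpx]
    e_dvd := hdvd }⟩

end Existence

/-! ### Stabilizers in `F` as groups of homeomorphisms of the line -/

section Stabilizers

open Equiv

/-- The map and its inverse preserve `[a,b]`, and a monotone bijection of an interval fixes its
ends. -/
theorem fix_endpoints {p : Perm ℝ} (hp : p ∈ PL) {a b : ℝ} (hab : a ≤ b)
    (h : ∀ x ∉ Set.Icc a b, p x = x) : p a = a ∧ p b = b := by
  have hm := (strictMono_of_mem_PL hp).monotone
  have ha := apply_mem_of_fix_compl h (Set.left_mem_Icc.2 hab)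
  have hb := apply_mem_of_fix_compl h (Set.right_mem_Icc.2 hab)
  have hi : ∀ x ∉ Set.Icc a b, p⁻¹ x = x := fun x hx => inv_fix (h x hx)
  have ha' := apply_mem_of_fix_compl hi (Set.left_mem_Icc.2 hab)
  have hb' := apply_mem_of_fix_compl hi (Set.right_mem_Icc.2 hab)
  constructor
  · refine le_antisymm ?_ ha.1
    have := hm ha'.1
    rwa [← Perm.mul_apply, mul_inv_cancel, Perm.one_apply] at this
  · refine le_antisymm hb.2 ?_
    have := hm hb'.2
    rwa [← Perm.mul_apply, mul_inv_cancel, Perm.one_apply] at this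

theorem mem_stab_iff {f : F} {U : Set ℝ} :
    f ∈ stab U ↔ ∀ x ∈ U, ext f x = x := by
  constructor
  · intro h x hx
    by_cases hI : x ∈ Set.Icc (0 : ℝ) 1
    · rw [ext_apply f ⟨x, hI⟩, F.val_inv_eq (h ⟨x, hI⟩ hx)]
    · exact ext_apply_of_notMem f hI
  · intro h x hx
    refine Subtype.ext ?_
    rw [← ext_inv_apply, inv_fix (h x hx)]

variable {m : ℕ} {v : Fin (m + 2) → ℝ}

theorem map_ext_stab {U : Set ℝ} (h0 : v 0 = 1) (h1 : v (Fin.last (m + 1)) = 0)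
    (hv : ∀ x, (∃ k, v k = x) ↔ x = 0 ∨ x = 1 ∨ x ∈ U) : (stab U).map ext = fixer v := by
  ext p
  rw [mem_fixer, h0, h1]
  constructor
  · rintro ⟨f, hf, rfl⟩
    refine ⟨ext_mem_PL f, fun k => ?_, ext_apply_of_notMem_Icc f⟩
    obtain ⟨e0, e1⟩ := fix_endpoints (ext_mem_PL f) zero_le_one (ext_apply_of_notMem_Icc f)
    rcases (hv (v k)).1 ⟨k, rfl⟩ with h | h | h
    · rw [h, e0]
    · rw [h, e1]
    · exact mem_stab_iff.1 hf _ h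
  · rintro ⟨hp, hk, hI⟩
    obtain ⟨f, rfl⟩ := exists_ext_eq hp hI
    refine ⟨f, mem_stab_iff.2 fun x hx => ?_, rfl⟩
    obtain ⟨k, rfl⟩ := (hv x).2 (.inr (.inr hx))
    exact hk k

theorem map_ext_B {V : Finset ℝ} (hV : (V : Set ℝ) ⊆ Set.Icc 0 1) (anti : StrictAnti v)
    (hv : ∀ x, (∃ k, v k = x) ↔ x ∈ V) : (B V).map ext = fixer v := by
  have hmem : ∀ k, v k ∈ V := fun k => (hv _).1 ⟨k, rfl⟩
  have hsup : sSup (V : Set ℝ) = v 0 := by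
    refine IsGreatest.csSup_eq ⟨hmem 0, fun x hx => ?_⟩
    obtain ⟨k, rfl⟩ := (hv x).2 hx
    exact anti.antitone (Fin.zero_le k)
  have hinf : sInf (V : Set ℝ) = v (Fin.last (m + 1)) := by
    refine IsLeast.csInf_eq ⟨hmem _, fun x hx => ?_⟩
    obtain ⟨k, rfl⟩ := (hv x).2 hx
    exact anti.antitone (Fin.le_last k)
  ext p
  rw [mem_fixer, B, hsup, hinf, supportedIn]
  constructor
  · rintro ⟨f, ⟨hf, hf'⟩, rfl⟩
    have hI : ∀ x ∉ Set.Icc (v (Fin.last (m + 1))) (v 0), ext f x = x :=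
      fun x hx => mem_stab_iff.1 hf x hx
    refine ⟨ext_mem_PL f, fun k => ?_, hI⟩
    obtain ⟨e0, e1⟩ := fix_endpoints (ext_mem_PL f) (anti.antitone (Fin.zero_le _)) hI
    by_cases h : v k ∈ ({v (Fin.last (m + 1)), v 0} : Set ℝ)
    · rcases h with h | h
      · rw [h, e0]
      · rw [Set.mem_singleton_iff.1 h, e1]
    · exact mem_stab_iff.1 hf' _ ⟨hmem k, h⟩
  · rintro ⟨hp, hk, hI⟩
    obtain ⟨f, rfl⟩ := exists_ext_eq hp fun x hx => hI x fun h =>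
      hx ⟨(hV (hmem _)).1.trans h.1, h.2.trans (hV (hmem _)).2⟩
    refine ⟨f, ⟨mem_stab_iff.2 fun x hx => hI x hx, mem_stab_iff.2 fun x hx => ?_⟩, rfl⟩
    obtain ⟨k, rfl⟩ := (hv x).2 hx.1
    exact hk k

/-- The decreasing enumeration of a finite set. -/
def revEnum (W : Finset ℝ) {k : ℕ} (h : W.card = k) (i : Fin k) : ℝ := W.orderEmbOfFin h i.rev

theorem revEnum_strictAnti (W : Finset ℝ) {k : ℕ} (h : W.card = k) : StrictAnti (revEnum W h) :=
  fun _ _ hij => (W.orderEmbOfFin h).strictMono (Fin.rev_lt_rev.2 hij)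

theorem exists_revEnum_eq_iff (W : Finset ℝ) {k : ℕ} (h : W.card = k) (x : ℝ) :
    (∃ i, revEnum W h i = x) ↔ x ∈ W := by
  rw [← Finset.mem_coe, ← Finset.range_orderEmbOfFin W h]
  exact ⟨fun ⟨i, hi⟩ => ⟨_, hi⟩, fun ⟨i, hi⟩ => ⟨i.rev, by rw [revEnum, Fin.rev_rev, hi]⟩⟩

theorem nonempty_frame_of_stab {U : Finset ℝ}
    (hU : ∀ u ∈ U, u ∈ Set.Ioo (0 : ℝ) 1 ∧ u ∈ Set.range ((↑) : ℚ → ℝ) ∧ ¬ IsDyadic u)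
    (hcard : U.card = m) :
    ∃ v : Fin (m + 2) → ℝ, Nonempty (Frame v) ∧ (stab (U : Set ℝ)).map ext = fixer v := by
  classical
  have h1U : (1 : ℝ) ∉ U := fun h => lt_irrefl _ (hU 1 h).1.2
  have h0U : (0 : ℝ) ∉ insert 1 U := by
    rw [Finset.mem_insert, not_or]
    exact ⟨zero_ne_one, fun h => lt_irrefl _ (hU 0 h).1.1⟩
  have hW : (insert 0 (insert 1 U)).card = m + 2 := by
    rw [Finset.card_insert_of_notMem h0U, Finset.card_insert_of_notMem h1U, hcard]
  have anti := revEnum_strictAnti _ hW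
  have hv : ∀ x, (∃ i, revEnum _ hW i = x) ↔ x = 0 ∨ x = 1 ∨ x ∈ U := fun x => by
    rw [exists_revEnum_eq_iff, Finset.mem_insert, Finset.mem_insert]
  generalize revEnum _ hW = v at anti hv
  have hI : ∀ k, v k ∈ Set.Icc (0 : ℝ) 1 := fun k => by
    rcases (hv _).1 ⟨k, rfl⟩ with h | h | h
    · rw [h]; exact ⟨le_rfl, zero_le_one⟩
    · rw [h]; exact ⟨zero_le_one, le_rfl⟩
    · exact ⟨(hU _ h).1.1.le, (hU _ h).1.2.le⟩
  have h0 : v 0 = 1 := by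
    obtain ⟨k, hk⟩ := (hv 1).2 (.inr (.inl rfl))
    exact le_antisymm (hI 0).2 (hk ▸ anti.antitone (Fin.zero_le k))
  have h1 : v (Fin.last (m + 1)) = 0 := by
    obtain ⟨k, hk⟩ := (hv 0).2 (.inl rfl)
    exact le_antisymm (hk ▸ anti.antitone (Fin.le_last k)) (hI _).1
  have hin : ∀ j : Fin m, v j.succ.castSucc ∈ U := fun j => by
    rcases (hv _).1 ⟨j.succ.castSucc, rfl⟩ with h | h | h
    · rw [← h1] at h
      exact absurd (anti.injective h) (Fin.castSucc_lt_last _).ne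
    · rw [← h0] at h
      exact absurd (anti.injective h) (Fin.succ_ne_zero j.castSucc)
    · exact h
  exact ⟨v, nonempty_frame anti (fun j => (hU _ (hin j)).2.2) (fun j => (hU _ (hin j)).2.1)
    (h0 ▸ IsDyadic.one) (h1 ▸ IsDyadic.zero), map_ext_stab h0 h1 hv⟩

theorem isDyadic_of_numberClass {x : ℝ} (h : numberClass x = 1) : IsDyadic x := by
  by_contra hx
  rw [numberClass, if_neg hx] at h
  split_ifs at h
  all_goals omega

theorem of_numberClass_eq_two {x : ℝ} (h : numberClass x = 2) :
    ¬ IsDyadic x ∧ x ∈ Set.range ((↑) : ℚ → ℝ) := by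
  rw [numberClass] at h
  split_ifs at h with h1 h2
  · omega
  · exact ⟨h1, h2⟩
  · omega

theorem nonempty_frame_of_B {V : Finset ℝ} (hV : (V : Set ℝ) ⊆ Set.Icc 0 1)
    (htype : typeWord V = [1] ++ List.replicate m 2 ++ [1]) :
    ∃ v : Fin (m + 2) → ℝ, Nonempty (Frame v) ∧ (B V).map ext = fixer v := by
  have hcard : V.card = m + 2 := by
    have := congrArg List.length htype
    rw [typeWord, List.length_map, Finset.length_sort] at this
    simpa [add_comm, add_left_comm] using this
  have hclass : ∀ i : Fin (m + 2), some (numberClass (V.orderEmbOfFin hcard i)) =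
      ([1] ++ List.replicate m 2 ++ [1])[(i : ℕ)]? := by
    intro i
    have hi : (i : ℕ) < (V.sort (· ≤ ·)).length := by
      rw [Finset.length_sort, hcard]; exact i.2
    rw [← htype, typeWord, List.getElem?_map, List.getElem?_eq_getElem hi,
      Finset.orderEmbOfFin_apply]
    rfl
  have hone : ∀ i : Fin (m + 2), (i = 0 ∨ i = Fin.last (m + 1)) →
      numberClass (V.orderEmbOfFin hcard i) = 1 := by
    rintro i (rfl | rfl)
    · simpa using hclass 0
    · simpa [List.getElem?_append] using hclass (Fin.last (m + 1))
  have htwo : ∀ j : Fin m, numberClass (V.orderEmbOfFin hcard j.succ.castSucc) = 2 := by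
    intro j
    have := hclass j.succ.castSucc
    simpa [List.getElem?_append] using this
  refine ⟨revEnum V hcard, nonempty_frame (revEnum_strictAnti V hcard) (fun j => ?_)
    (fun j => ?_) ?_ ?_, map_ext_B hV (revEnum_strictAnti V hcard)
      (exists_revEnum_eq_iff V hcard)⟩
  -- `12^m1` is a palindrome, so passing to the decreasing enumeration does not change the type.
  · have := htwo j.rev
    rw [revEnum, Fin.rev_castSucc, Fin.rev_succ, ← Fin.succ_castSucc] at *
    exact (of_numberClass_eq_two this).1
  · have := htwo j.rev
    rw [revEnum, Fin.rev_castSucc, Fin.rev_succ, ← Fin.succ_castSucc] at *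
    exact (of_numberClass_eq_two this).2
  · exact isDyadic_of_numberClass (hone _ (.inr (Fin.rev_zero _)))
  · exact isDyadic_of_numberClass (hone _ (.inl (Fin.rev_last _)))

end Stabilizers

/-! ### Transport to subgroups of `F`, and properness of the conjugated base -/

section Transport

variable {K G G' : Type*} [Group K] [Group G] [Group G'] {m : ℕ} {φ : Fin m → K →* K}
  {ι : K →* G} {t : Fin m → G}

theorem AscRel.map (h : AscRel φ ι t) (f : G →* G') :
    AscRel φ (f.comp ι) (fun j => f (t j)) where
  comm := fun i j => (h.comm i j).map f
  conj := fun j k => by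
    rw [MonoidHom.comp_apply, MonoidHom.comp_apply, ← h.conj, map_mul, map_mul, map_inv]

/-- Conjugation turns the image of `K` into the image of `φ j`, which is smaller because `ι` is
injective. -/
theorem AscRel.map_conj_lt (h : AscRel φ ι t) (hι : Function.Injective ι) {j : Fin m}
    (hj : ¬ Function.Surjective (φ j)) :
    ι.range.map (MulAut.conj (t j)⁻¹).toMonoidHom < ι.range := by
  have e : ∀ k, (MulAut.conj (t j)⁻¹).toMonoidHom (ι k) = ι (φ j k) := fun k => by
    rw [← h.conj]; simp
  refine lt_of_le_of_ne ?_ fun heq => hj fun k => ?_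
  · rintro _ ⟨_, ⟨k, rfl⟩, rfl⟩
    exact ⟨_, (e k).symm⟩
  · have : ι k ∈ ι.range.map (MulAut.conj (t j)⁻¹).toMonoidHom := by
      rw [heq]; exact ⟨k, rfl⟩
    obtain ⟨_, ⟨k', rfl⟩, hk'⟩ := this
    exact ⟨k', hι ((e k').symm.trans hk')⟩

theorem letterEnd_not_surjective (j : Fin m) : ¬ Function.Surjective (letterEnd j) := by
  intro h
  refine endLeft_not_surjective fun f => ?_
  obtain ⟨k, hk⟩ := h (incl j.castSucc f)
  refine ⟨k j.castSucc, ?_⟩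
  have := congrFun hk j.castSucc
  simpa [letterEnd, letterComponent] using this

/-- The isomorphism between a subgroup of `F` and the corresponding group of homeomorphisms of
the line. -/
def extEquiv {H : Subgroup F} {L : Subgroup (Equiv.Perm ℝ)} (h : H.map ext = L) : H ≃* L :=
  (H.equivMapOfInjective ext ext_injective).trans (MulEquiv.subgroupCongr h)

end Transport

end ThompsonStab

end

/-! ### The main theorem -/

theorem mainTheorem11 (m : ℕ) (U : Finset ℝ) (hcard : U.card = m)
    (hU : ∀ u ∈ U, u ∈ Set.Ioo (0 : ℝ) 1 ∧ u ∈ Set.range ((↑) : ℚ → ℝ) ∧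
      ¬ ThompsonStab.IsDyadic u) :
    (∀ V : Finset ℝ, (V : Set ℝ) ⊆ Set.Icc 0 1 →
        ThompsonStab.typeWord V = [1] ++ List.replicate m 2 ++ [1] →
        Nonempty (ThompsonStab.stab (U : Set ℝ) ≃* ThompsonStab.B V)) ∧
    ∃ (ι : ThompsonStab.BaseGroup m →* ThompsonStab.stab (U : Set ℝ))
      (t : Fin m → ThompsonStab.stab (U : Set ℝ))
      (φ : Fin m → (ThompsonStab.BaseGroup m →* ThompsonStab.BaseGroup m)),
      ThompsonStab.IsIteratedAscHNN (ThompsonStab.BaseGroup m) m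
        (ThompsonStab.stab (U : Set ℝ)) ι t ∧
      (∀ i j, Commute (t i) (t j)) ∧
      (∀ j, ι.range.map (MulAut.conj (t j)⁻¹).toMonoidHom < ι.range) ∧
      (∀ j k, (t j)⁻¹ * ι k * t j = ι (φ j k)) ∧
      ∀ j : Fin m,
        (∀ i : Fin (m + 1), i ≠ j.castSucc → i ≠ j.succ →
          φ j (ThompsonStab.incl i ThompsonStab.x0) = ThompsonStab.incl i ThompsonStab.x0 ∧
          φ j (ThompsonStab.incl i ThompsonStab.x1) = ThompsonStab.incl i ThompsonStab.x1) ∧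
        φ j (ThompsonStab.incl j.castSucc ThompsonStab.x0) =
          ThompsonStab.incl j.castSucc
            (ThompsonStab.x0 * ThompsonStab.x1 * ThompsonStab.x0⁻¹) ∧
        φ j (ThompsonStab.incl j.castSucc ThompsonStab.x1) =
          ThompsonStab.incl j.castSucc ThompsonStab.x1 ∧
        φ j (ThompsonStab.incl j.succ ThompsonStab.x0) =
          ThompsonStab.incl j.succ (ThompsonStab.x0 * ThompsonStab.x1⁻¹) ∧
        φ j (ThompsonStab.incl j.succ ThompsonStab.x1) =
          ThompsonStab.incl j.succ
            (ThompsonStab.x1 ^ 2 * ThompsonStab.x2⁻¹ * ThompsonStab.x1⁻¹) := by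
  open ThompsonStab in
  obtain ⟨v, ⟨R⟩, hv⟩ := nonempty_frame_of_stab hU hcard
  refine ⟨fun V hV htype => ?_, ?_⟩
  · obtain ⟨v', ⟨R'⟩, hv'⟩ := nonempty_frame_of_B hV htype
    -- Both frames satisfy the relations for the same endomorphisms `letterEnd`, whatever the points
    -- are.
    obtain ⟨E⟩ := nonempty_mulEquiv_of_ascRel R.ascRel R'.ascRel R.base_injective
      R'.base_injective R.ascChar R'.ascChar R.base_sup_letters R'.base_sup_letters
    exact ⟨(extEquiv hv).trans (E.trans (extEquiv hv').symm)⟩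
  · let E := (extEquiv hv).symm
    have hrel := R.ascRel.map E.toMonoidHom
    have hinj : Function.Injective (E.toMonoidHom.comp R.base) :=
      E.injective.comp R.base_injective
    refine ⟨E.toMonoidHom.comp R.base, fun j => E (R.letter j), letterEnd,
      (R.ascRel.isIteratedAscHNN R.base_injective R.ascChar R.base_sup_letters).congr E,
      hrel.comm, fun j => hrel.map_conj_lt hinj (letterEnd_not_surjective j), hrel.conj,
      fun j => ⟨fun i h1 h2 => ?_, ?_, ?_, ?_, ?_⟩⟩
    · rw [letterEnd_incl, letterEnd_incl, letterComponent, if_neg h1, if_neg h2]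
      exact ⟨rfl, rfl⟩
    · rw [letterEnd_incl, letterComponent, if_pos rfl, endLeft_x0]
    · rw [letterEnd_incl, letterComponent, if_pos rfl, endLeft_x1]
    all_goals
      have hne : j.succ ≠ j.castSucc := Fin.castSucc_lt_succ.ne'
    · rw [letterEnd_incl, letterComponent, if_neg hne, if_pos rfl, endRight_x0]
    · rw [letterEnd_incl, letterComponent, if_neg hne, if_pos rfl, endRight_x1]
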